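/- **Theorem.** An instance $I=(G,N,\mathcal U)$ of the connected fair division problem consists of a finite undirected graph $G=(V,E)$ whose vertices are called items, a finite set $N=\{1,\dots,n\}$ of players, and, for each $i\in N$, a utility function $u_i:V\to\mathbb Q_{\ge 0}$ with $\sum_{v\in V}u_i(v)=1$; put $u_i(X)=\sum_{v\in X}u_i(v)$ for $X\subseteq V$. A valid allocation assigns to each player $i$ a (possibly empty) set $\pi(i)\subseteq V$ that is connected in $G$, such that $\pi(i)\cap\pi(j)=\emptyset$ for $i\ne j$ (items may remain unallocated). It is proportional if $u_i(\pi(i))\ge \frac1n$ for all $i\in N$. The decision problem Prop-CFD asks whether a given instance $I$ admits a proportional valid allocation. Prop-CFD is solvable in polynomial time if $G$ is a star: there are an algorithm and a polynomial $T$ such that, on every instance $I$ whose graph $G$ is a star (that is, some vertex $c$ is adjacent to all other vertices and there are no other edges), the algorithm decides correctly whether $I$ admits a proportional valid allocation within time $T(|I|)$, where $|I|$ is the length of the encoding of $I$, with $G$ given by its adjacency matrix and the numerators and denominators of the utilities written in binary. (Time is measured on a random access machine with logarithmic cost, which is polynomially equivalent to a Turing machine.) -/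

import Mathlib

/-! ### Connected fair division -/

/-- An instance of the connected fair division problem: a graph on the items `0, …, m - 1`,
`n` players, and for each player a nonnegative rational utility function of total value `1`. -/
structure CFDInstance where
  n : ℕ
  m : ℕ
  G : SimpleGraph (Fin m)
  u : Fin n → Fin m → ℚ
  u_nonneg : ∀ i v, 0 ≤ u i v
  u_sum : ∀ i, ∑ v, u i v = 1

namespace CFDInstance

/-- An allocation assigns a bundle of items to each player. -/
abbrev Allocation (I : CFDInstance) : Type := Fin I.n → Finset (Fin I.m)

/-- Additive value of a bundle. -/
def value (I : CFDInstance) (i : Fin I.n) (X : Finset (Fin I.m)) : ℚ := ∑ v ∈ X, I.u i v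

/-- Every bundle is connected in `G` (the empty bundle is allowed), and no item is allocated
twice. Items may stay unallocated. -/
def IsValid (I : CFDInstance) (π : I.Allocation) : Prop :=
  (∀ i, (I.G.induce (π i : Set (Fin I.m))).Preconnected) ∧
    ∀ i j, i ≠ j → Disjoint (π i) (π j)

/-- Every player gets value at least `1 / n`. -/
def IsProportional (I : CFDInstance) (π : I.Allocation) : Prop :=
  ∀ i, 1 / (I.n : ℚ) ≤ I.value i (π i)

/-- The question asked by the decision problem Prop-CFD. -/
def PropCFD (I : CFDInstance) : Prop := ∃ π : I.Allocation, I.IsValid π ∧ I.IsProportional π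

/-- The graph of the instance is a star; the center can be any item. -/
def IsStar (I : CFDInstance) : Prop := ∃ c : Fin I.m, I.G = SimpleGraph.starGraph c

open Classical in
/-- The instance as a list of natural numbers: `n`, `m`, the adjacency matrix of `G` row by row,
and then, player by player and item by item, numerator and denominator of the utility. -/
noncomputable def encode (I : CFDInstance) : List ℕ :=
  [I.n, I.m] ++
    ((List.finRange I.m).flatMap fun v =>
      (List.finRange I.m).map fun w => if I.G.Adj v w then 1 else 0) ++
    ((List.finRange I.n).flatMap fun i =>
      (List.finRange I.m).flatMap fun v => [(I.u i v).num.toNat, (I.u i v).den])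

end CFDInstance

/-! ### Random access machines with logarithmic cost

Programs are while-programs acting on registers and on a memory that can be addressed indirectly;
all cells hold natural numbers. Every number and every address that is handled is charged its
binary length, so that running times agree with Turing machine times up to a polynomial. -/

namespace RAM

/-- Length of a natural number in binary, plus one. -/
def len (x : ℕ) : ℕ := Nat.size x + 1

structure State where
  reg : ℕ → ℕ
  mem : ℕ → ℕ

/-- Arithmetic operations; subtraction is truncated at `0`, division rounds down. -/
inductive Op where
  | add
  | sub
  | mul
  | div

def Op.eval : Op → ℕ → ℕ → ℕ
  | .add, x, y => x + y
  | .sub, x, y => x - y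
  | .mul, x, y => x * y
  | .div, x, y => x / y

/-- Expressions: constants, registers, the memory cell whose address is the value of an expression,
and arithmetic. -/
inductive Expr where
  | lit (k : ℕ)
  | reg (r : ℕ)
  | load (e : Expr)
  | bin (o : Op) (e₁ e₂ : Expr)

def Expr.eval (s : State) : Expr → ℕ
  | .lit k => k
  | .reg r => s.reg r
  | .load e => s.mem (e.eval s)
  | .bin o e₁ e₂ => o.eval (e₁.eval s) (e₂.eval s)

/-- Logarithmic cost of evaluating an expression. -/
def Expr.cost (s : State) : Expr → ℕ
  | .lit k => len k
  | .reg r => len r + len (s.reg r)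
  | .load e => e.cost s + len (e.eval s) + len (s.mem (e.eval s))
  | .bin _ e₁ e₂ => e₁.cost s + e₂.cost s + len (e₁.eval s) + len (e₂.eval s)

/-- Programs. A test `e` succeeds if the value of `e` is not `0`. -/
inductive Prog where
  | skip
  | assign (r : ℕ) (e : Expr)
  | store (a e : Expr)
  | seq (p q : Prog)
  | ite (e : Expr) (p q : Prog)
  | loop (e : Expr) (p : Prog)

def State.setReg (s : State) (r x : ℕ) : State := { s with reg := Function.update s.reg r x }

def State.setMem (s : State) (a x : ℕ) : State := { s with mem := Function.update s.mem a x }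

/-- `Exec p s t s'`: started in state `s`, the program `p` halts in state `s'`, and the whole
execution has logarithmic cost `t`. -/
inductive Exec : Prog → State → ℕ → State → Prop where
  | skip (s : State) : Exec .skip s 1 s
  | assign (r : ℕ) (e : Expr) (s : State) :
      Exec (.assign r e) s (e.cost s + len r + len (e.eval s)) (s.setReg r (e.eval s))
  | store (a e : Expr) (s : State) :
      Exec (.store a e) s (a.cost s + e.cost s + len (a.eval s) + len (e.eval s))
        (s.setMem (a.eval s) (e.eval s))
  | seq {p q : Prog} {s s' s'' : State} {t t' : ℕ} :
      Exec p s t s' → Exec q s' t' s'' → Exec (.seq p q) s (t + t') s''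
  | ite_true {e : Expr} {p q : Prog} {s s' : State} {t : ℕ} :
      e.eval s ≠ 0 → Exec p s t s' → Exec (.ite e p q) s (e.cost s + len (e.eval s) + t) s'
  | ite_false {e : Expr} {p q : Prog} {s s' : State} {t : ℕ} :
      e.eval s = 0 → Exec q s t s' → Exec (.ite e p q) s (e.cost s + len (e.eval s) + t) s'
  | loop_true {e : Expr} {p : Prog} {s s' s'' : State} {t t' : ℕ} :
      e.eval s ≠ 0 → Exec p s t s' → Exec (.loop e p) s' t' s'' →
        Exec (.loop e p) s (e.cost s + len (e.eval s) + t + t') s''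
  | loop_false {e : Expr} {p : Prog} {s : State} :
      e.eval s = 0 → Exec (.loop e p) s (e.cost s + len (e.eval s)) s

/-- Executions are deterministic: the final state and the cost are determined by the program and
the initial state. -/
theorem Exec.deterministic {p : Prog} {s s₁ s₂ : State} {t₁ t₂ : ℕ}
    (h₁ : Exec p s t₁ s₁) (h₂ : Exec p s t₂ s₂) : t₁ = t₂ ∧ s₁ = s₂ := by
  induction h₁ generalizing t₂ s₂ with
  | skip | assign | store => cases h₂; exact ⟨rfl, rfl⟩
  | seq _ _ ih ih' =>
    cases h₂ with
    | seq a b =>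
      obtain ⟨rfl, rfl⟩ := ih a
      obtain ⟨rfl, rfl⟩ := ih' b
      exact ⟨rfl, rfl⟩
  | ite_true h _ ih =>
    cases h₂ with
    | ite_true _ a => obtain ⟨rfl, rfl⟩ := ih a; exact ⟨rfl, rfl⟩
    | ite_false h' _ => exact absurd h' h
  | ite_false h _ ih =>
    cases h₂ with
    | ite_true h' _ => exact absurd h h'
    | ite_false _ a => obtain ⟨rfl, rfl⟩ := ih a; exact ⟨rfl, rfl⟩
  | loop_true h _ _ ih ih' =>
    cases h₂ with
    | loop_true _ a b =>
      obtain ⟨rfl, rfl⟩ := ih a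
      obtain ⟨rfl, rfl⟩ := ih' b
      exact ⟨rfl, rfl⟩
    | loop_false h' => exact absurd h' h
  | loop_false h =>
    cases h₂ with
    | loop_true h' _ _ => exact absurd h h'
    | loop_false _ => exact ⟨rfl, rfl⟩

/-- Initially the input list occupies the first memory cells; everything else is `0`. -/
def init (l : List ℕ) : State where
  reg := fun _ => 0
  mem := fun a => l.getD a 0

/-- Total binary length of an input list. -/
def inputSize (l : List ℕ) : ℕ := (l.map len).sum

/-- The decision problem `Q`, restricted to the inputs satisfying `D` and presented through the
encoding `enc`, is solvable in polynomial time: one program, with one polynomial time bound in the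
binary length of the input, halts on every input in `D` with the answer (`1` for yes, `0` for no)
in register `0`. -/
def SolvableInPolyTime {α : Type} (enc : α → List ℕ) (D Q : α → Prop) : Prop :=
  ∃ (p : Prog) (T : Polynomial ℕ), ∀ a, D a →
    ∃ (t : ℕ) (s : State), Exec p (init (enc a)) t s ∧ t ≤ T.eval (inputSize (enc a)) ∧
      (Q a → s.reg 0 = 1) ∧ (¬ Q a → s.reg 0 = 0)

end RAM

/-!
A connected set of items of a star that avoids the center has at most one element. So once it is
fixed which player `k` may own the center, every other player must receive a single item worth at
least `1 / n` to that player, and `k` takes all the rest; this satisfies `k` if and only if the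
`n - 1` items given away are worth at most `1 - 1 / n` to `k`. The sets of items that can be given
away form a transversal matroid, so offering the items in order of increasing worth to `k`, and
choosing each one that can be matched together with those already chosen, yields `n - 1` items of
least total worth whenever `n - 1` items can be matched at all.

To match one more item, hand it to a player of least height who wants it, where the height of a
player counts the items the player received during this attempt, and continue with the item that
player gives up. The height of the holder of an item exceeds those of the players who want the item
by at most one, so once the item in hand is wanted only at height `n` or more, some gap in the
heights exhibits a violation of Hall's condition.

The running time is polynomial because all loops are bounded by `n` or the number of items, and
because stored numbers are only multiplied by entries of the input, so that each step lengthens them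
by at most a constant multiple of the length of the input.
-/

/-! ### Logarithmic cost -/

namespace RAM

theorem len_pos (x : ℕ) : 0 < len x := Nat.succ_pos _

@[simp] theorem len_zero : len 0 = 1 := rfl

@[simp] theorem len_one : len 1 = 2 := by simp [len]

theorem len_mono {x y : ℕ} (h : x ≤ y) : len x ≤ len y :=
  Nat.add_le_add_right (Nat.size_le_size h) 1

theorem len_add_le_max (x y : ℕ) : len (x + y) ≤ max (len x) (len y) + 1 := by
  have hx := (Nat.lt_size_self x).trans_le (Nat.pow_le_pow_right two_pos (le_max_left _ y.size))
  have hy := (Nat.lt_size_self y).trans_le (Nat.pow_le_pow_right two_pos (le_max_right x.size _))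
  have : (x + y).size ≤ max x.size y.size + 1 := by
    rw [Nat.size_le, pow_succ]
    omega
  simp only [len]
  omega

theorem len_mul_le (x y : ℕ) : len (x * y) ≤ len x + len y := by
  have : (x * y).size ≤ x.size + y.size := by
    rw [Nat.size_le, pow_add]
    exact Nat.mul_lt_mul'' (Nat.lt_size_self x) (Nat.lt_size_self y)
  simp only [len]
  omega

theorem Op.len_eval_le (o : Op) (x y : ℕ) : len (o.eval x y) ≤ len x + len y := by
  cases o with
  | add =>
    have := len_add_le_max x y
    have := len_pos x
    have := len_pos y
    simp only [Op.eval]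
    omega
  | sub => exact (len_mono (Nat.sub_le x y)).trans (Nat.le_add_right _ _)
  | mul => exact len_mul_le x y
  | div => exact (len_mono (Nat.div_le_self x y)).trans (Nat.le_add_right _ _)

/-- Every register and every memory cell holds a number of length at most `L`. -/
def State.Bounded (L : ℕ) (s : State) : Prop :=
  (∀ r, len (s.reg r) ≤ L) ∧ ∀ a, len (s.mem a) ≤ L

namespace State.Bounded

variable {L L' : ℕ} {s : State}

theorem mono (h : s.Bounded L) (hL : L ≤ L') : s.Bounded L' :=
  ⟨fun r => (h.1 r).trans hL, fun a => (h.2 a).trans hL⟩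

theorem setReg (h : s.Bounded L) {r x : ℕ} (hx : len x ≤ L) : (s.setReg r x).Bounded L :=
  ⟨Function.forall_update_iff s.reg (fun _ y => len y ≤ L) |>.2 ⟨hx, fun q _ => h.1 q⟩, h.2⟩

theorem setMem (h : s.Bounded L) {a x : ℕ} (hx : len x ≤ L) : (s.setMem a x).Bounded L :=
  ⟨h.1, Function.forall_update_iff s.mem (fun _ y => len y ≤ L) |>.2 ⟨hx, fun q _ => h.2 q⟩⟩

end State.Bounded

/-- In states whose numbers have length at most `L`, evaluating the expression and handling its
value costs at most `C * L`. -/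
def Expr.LinearCost (C : ℕ) (e : Expr) : Prop :=
  ∀ s L, 0 < L → State.Bounded L s → e.cost s + len (e.eval s) ≤ C * L

theorem Expr.exists_linearCost (e : Expr) : ∃ C, e.LinearCost C := by
  induction e with
  | lit k =>
    refine ⟨len k + len k, fun s L hL _ => ?_⟩
    exact Nat.le_mul_of_pos_right _ hL
  | reg r =>
    refine ⟨len r + 2, fun s L hL hs => ?_⟩
    have := hs.1 r
    have := Nat.le_mul_of_pos_right (len r) hL
    simp only [cost, eval]
    linarith
  | load e ih =>
    obtain ⟨C, hC⟩ := ih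
    refine ⟨C + 2, fun s L hL hs => ?_⟩
    have := hC s L hL hs
    have := hs.2 (e.eval s)
    simp only [cost, eval]
    linarith
  | bin o e₁ e₂ ih₁ ih₂ =>
    obtain ⟨C₁, hC₁⟩ := ih₁
    obtain ⟨C₂, hC₂⟩ := ih₂
    refine ⟨2 * (C₁ + C₂), fun s L hL hs => ?_⟩
    have := hC₁ s L hL hs
    have := hC₂ s L hL hs
    have := o.len_eval_le (e₁.eval s) (e₂.eval s)
    simp only [cost, eval]
    linarith

theorem length_le_inputSize (l : List ℕ) : l.length ≤ inputSize l := by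
  have hone : ∀ y ∈ l.map len, 1 ≤ y := by simpa using fun x _ => Nat.succ_le_of_lt (len_pos x)
  simpa [inputSize] using List.card_nsmul_le_sum (l.map len) 1 hone

theorem len_le_inputSize {l : List ℕ} {x : ℕ} (hx : x ∈ l) : len x ≤ inputSize l :=
  List.le_sum_of_mem (List.mem_map_of_mem hx)

theorem bounded_init {l : List ℕ} (hl : 0 < l.length) : (init l).Bounded (inputSize l) := by
  have hpos : 1 ≤ inputSize l := hl.trans_le (length_le_inputSize l)
  refine ⟨fun _ => hpos, fun a => ?_⟩
  by_cases ha : a < l.length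
  · simp only [init, List.getD_eq_getElem _ _ ha]
    exact len_le_inputSize (List.getElem_mem ha)
  · simpa only [init, List.getD_eq_default _ _ (not_lt.1 ha), len_zero] using hpos

end RAM

/-! ### Programs with bounded loops -/

namespace RAM

/-- The data a bounded-loop program works on, besides its read-only input: variables named by `V`
and infinite arrays named by `A`. -/
structure Store (V A : Type*) where
  var : V → ℕ
  arr : A → ℕ → ℕ

/-- Expressions of bounded-loop programs. `input e` is the entry of the input list at position
`e`. -/
inductive ForExpr (V A : Type*) where
  | lit (k : ℕ)
  | var (x : V)
  | input (e : ForExpr V A)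
  | arr (a : A) (e : ForExpr V A)
  | bin (o : Op) (e₁ e₂ : ForExpr V A)

/-- Programs all of whose loops are bounded: in `upTo x k p` the variable `x` runs through the
numbers below entry `k` of the input. Hence every program halts, and if the loop bounds are small
it does so quickly. -/
inductive ForProg (V A : Type*) where
  | skip
  | set (x : V) (e : ForExpr V A)
  | store (a : A) (i e : ForExpr V A)
  | seq (p q : ForProg V A)
  | ite (e : ForExpr V A) (p q : ForProg V A)
  | upTo (x : V) (k : ℕ) (p : ForProg V A)

infixr:30 " ;; " => ForProg.seq
infix:40 " ::= " => ForProg.set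

/-- Entry `a` of the input; positions past the end read the last entry, so that the machine never
mistakes its work space for input. -/
def readInput (l : List ℕ) (a : ℕ) : ℕ := l.getD (min a (l.length - 1)) 0

theorem readInput_of_lt {l : List ℕ} {a : ℕ} (ha : a < l.length) : readInput l a = l.getD a 0 := by
  rw [readInput, min_eq_left (by omega)]

theorem readInput_mem {l : List ℕ} (hl : 0 < l.length) (a : ℕ) : readInput l a ∈ l := by
  rw [readInput, List.getD_eq_getElem _ _ (by omega)]
  exact List.getElem_mem _

variable {V A : Type*}

namespace Store

/-- The store before a program starts. -/
def zero : Store V A := ⟨fun _ => 0, fun _ _ => 0⟩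

/-- Assignment to a variable. -/
def setVar [DecidableEq V] (h : Store V A) (x : V) (k : ℕ) : Store V A :=
  { h with var := Function.update h.var x k }

/-- Assignment to an array entry. -/
def setArr [DecidableEq A] (h : Store V A) (a : A) (i k : ℕ) : Store V A :=
  { h with arr := Function.update h.arr a (Function.update (h.arr a) i k) }

@[simp] theorem setVar_var [DecidableEq V] (h : Store V A) (x : V) (k : ℕ) (y : V) :
    (h.setVar x k).var y = if y = x then k else h.var y := Function.update_apply ..

@[simp] theorem setVar_arr [DecidableEq V] (h : Store V A) (x : V) (k : ℕ) :
    (h.setVar x k).arr = h.arr := rfl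

@[simp] theorem setVar_setVar [DecidableEq V] (h : Store V A) (x : V) (k k' : ℕ) :
    (h.setVar x k).setVar x k' = h.setVar x k' := by
  simp only [setVar, Function.update_idem]

theorem setVar_comm [DecidableEq V] (h : Store V A) {x y : V} (hxy : x ≠ y) (k k' : ℕ) :
    (h.setVar x k).setVar y k' = (h.setVar y k').setVar x k := by
  simp only [setVar, Function.update_comm hxy]

@[simp] theorem setArr_var [DecidableEq A] (h : Store V A) (a : A) (i k : ℕ) :
    (h.setArr a i k).var = h.var := rfl

@[simp] theorem setArr_arr [DecidableEq A] (h : Store V A) (a : A) (i k : ℕ) (b : A) :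
    (h.setArr a i k).arr b = if b = a then Function.update (h.arr a) i k else h.arr b :=
  Function.update_apply ..

end Store

namespace ForExpr

/-- The value of an expression. -/
def eval (l : List ℕ) (h : Store V A) : ForExpr V A → ℕ
  | lit k => k
  | var x => h.var x
  | input e => readInput l (e.eval l h)
  | arr a e => h.arr a (e.eval l h)
  | bin o e₁ e₂ => o.eval (e₁.eval l h) (e₂.eval l h)

instance : Coe V (ForExpr V A) := ⟨var⟩
instance (k : ℕ) : OfNat (ForExpr V A) k := ⟨lit k⟩
instance : Add (ForExpr V A) := ⟨bin .add⟩
instance : Sub (ForExpr V A) := ⟨bin .sub⟩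
instance : Mul (ForExpr V A) := ⟨bin .mul⟩

/-- The test `e₁ < e₂`, by truncated subtraction. A test holds if its value is not `0`. -/
def lt (e₁ e₂ : ForExpr V A) : ForExpr V A := e₂ - e₁

/-- The test `e₁ ≤ e₂`. -/
def le (e₁ e₂ : ForExpr V A) : ForExpr V A := e₂ + 1 - e₁

/-- The test `e₁ ≠ e₂`. -/
def ne (e₁ e₂ : ForExpr V A) : ForExpr V A := (e₁ - e₂) + (e₂ - e₁)

/-- The conjunction of two tests. -/
def and (e₁ e₂ : ForExpr V A) : ForExpr V A := e₁ * e₂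

variable (l : List ℕ) (h : Store V A) (e e₁ e₂ : ForExpr V A)

@[simp] theorem eval_ofNat (k : ℕ) : eval l h ofNat(k) = k := rfl

@[simp] theorem eval_var (x : V) : (var x).eval l h = h.var x := rfl

@[simp] theorem eval_input : (input e).eval l h = readInput l (e.eval l h) := rfl

@[simp] theorem eval_arr (a : A) : (arr a e).eval l h = h.arr a (e.eval l h) := rfl

@[simp] theorem eval_add : (e₁ + e₂).eval l h = e₁.eval l h + e₂.eval l h := rfl

@[simp] theorem eval_sub : (e₁ - e₂).eval l h = e₁.eval l h - e₂.eval l h := rfl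

@[simp] theorem eval_mul : (e₁ * e₂).eval l h = e₁.eval l h * e₂.eval l h := rfl

@[simp] theorem eval_lt_eq_zero : (lt e₁ e₂).eval l h = 0 ↔ ¬ e₁.eval l h < e₂.eval l h := by
  simp only [lt, eval_sub]
  omega

@[simp] theorem eval_le_eq_zero : (le e₁ e₂).eval l h = 0 ↔ ¬ e₁.eval l h ≤ e₂.eval l h := by
  simp only [le, eval_sub, eval_add, eval_ofNat]
  omega

@[simp] theorem eval_ne_eq_zero : (ne e₁ e₂).eval l h = 0 ↔ e₁.eval l h = e₂.eval l h := by
  simp only [ne, eval_sub, eval_add]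
  omega

@[simp] theorem eval_and_eq_zero :
    (and e₁ e₂).eval l h = 0 ↔ e₁.eval l h = 0 ∨ e₂.eval l h = 0 := Nat.mul_eq_zero

end ForExpr

namespace ForProg

variable [DecidableEq V] [DecidableEq A]

/-- The store after running a program. -/
def run (l : List ℕ) : ForProg V A → Store V A → Store V A
  | skip, h => h
  | set x e, h => h.setVar x (e.eval l h)
  | store a i e, h => h.setArr a (i.eval l h) (e.eval l h)
  | seq p q, h => q.run l (p.run l h)
  | ite e p q, h => if e.eval l h = 0 then q.run l h else p.run l h
  | upTo x k p, h =>
      (fun h' => (p.run l h').setVar x ((p.run l h').var x + 1))^[readInput l k] (h.setVar x 0)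

section

variable (l : List ℕ) (h : Store V A)

@[simp] theorem run_skip : skip.run l h = h := rfl

@[simp] theorem run_set (x : V) (e : ForExpr V A) :
    (x ::= e).run l h = h.setVar x (e.eval l h) := rfl

@[simp] theorem run_store (a : A) (i e : ForExpr V A) :
    (store a i e).run l h = h.setArr a (i.eval l h) (e.eval l h) := rfl

@[simp] theorem run_seq (p q : ForProg V A) : (p ;; q).run l h = q.run l (p.run l h) := rfl

@[simp] theorem run_ite (e : ForExpr V A) (p q : ForProg V A) :
    (ite e p q).run l h = if e.eval l h = 0 then q.run l h else p.run l h := rfl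

end

/-- The variables a program may change. -/
def vars : ForProg V A → List V
  | skip => []
  | set x _ => [x]
  | store _ _ _ => []
  | seq p q => p.vars ++ q.vars
  | ite _ p q => p.vars ++ q.vars
  | upTo x _ p => x :: p.vars

/-- The arrays a program may change. -/
def arrs : ForProg V A → List A
  | skip => []
  | set _ _ => []
  | store a _ _ => [a]
  | seq p q => p.arrs ++ q.arrs
  | ite _ p q => p.arrs ++ q.arrs
  | upTo _ _ p => p.arrs

variable (l : List ℕ) {p : ForProg V A} (h : Store V A)

theorem run_var_of_notMem {y : V} (hy : y ∉ p.vars) : (p.run l h).var y = h.var y := by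
  induction p generalizing h with
  | skip => rfl
  | set x e => simp_all [vars]
  | store a i e => simp
  | seq p q hp hq =>
    simp only [vars, List.mem_append, not_or] at hy
    rw [run, hq _ hy.2, hp _ hy.1]
  | ite e p q hp hq =>
    simp only [vars, List.mem_append, not_or] at hy
    rw [run]
    split_ifs
    exacts [hq h hy.2, hp h hy.1]
  | upTo x k p hp =>
    simp only [vars, List.mem_cons, not_or] at hy
    rw [run]
    induction readInput l k with
    | zero => simp [hy.1]
    | succ N ih => rw [Function.iterate_succ_apply', Store.setVar_var, if_neg hy.1, hp _ hy.2, ih]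

theorem run_arr_of_notMem {a : A} (ha : a ∉ p.arrs) : (p.run l h).arr a = h.arr a := by
  induction p generalizing h with
  | skip => rfl
  | set x e => simp
  | store a i e => simp_all [arrs]
  | seq p q hp hq =>
    simp only [arrs, List.mem_append, not_or] at ha
    rw [run, hq _ ha.2, hp _ ha.1]
  | ite e p q hp hq =>
    simp only [arrs, List.mem_append, not_or] at ha
    rw [run]
    split_ifs
    exacts [hq h ha.2, hp h ha.1]
  | upTo x k p hp =>
    rw [run]
    induction readInput l k with
    | zero => simp
    | succ N ih => rw [Function.iterate_succ_apply', Store.setVar_arr, hp _ ha, ih]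

theorem run_upTo_induction {x : V} {k : ℕ} (hx : x ∉ p.vars) (inv : ℕ → Store V A → Prop)
    (zero : inv 0 (h.setVar x 0))
    (succ : ∀ j h', j < readInput l k → h'.var x = j →
      (∀ y ∉ x :: p.vars, h'.var y = h.var y) → (∀ a ∉ p.arrs, h'.arr a = h.arr a) → inv j h' →
      inv (j + 1) ((p.run l h').setVar x (j + 1))) :
    inv (readInput l k) ((upTo x k p).run l h) := by
  let iter (j : ℕ) : Store V A :=
    (fun h' => (p.run l h').setVar x ((p.run l h').var x + 1))^[j] (h.setVar x 0)
  suffices key : ∀ j ≤ readInput l k, (iter j).var x = j ∧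
      (∀ y ∉ x :: p.vars, (iter j).var y = h.var y) ∧ (∀ a ∉ p.arrs, (iter j).arr a = h.arr a) ∧
      inv j (iter j) from (key _ le_rfl).2.2.2
  intro j
  induction j with
  | zero =>
    refine fun _ => ⟨by simp [iter], fun y hy => ?_, fun a _ => rfl, zero⟩
    simp [iter, List.ne_of_not_mem_cons hy]
  | succ j ih =>
    intro hj
    obtain ⟨hcounter, hvar, harr, hinv⟩ := ih (by omega)
    have hstep : iter (j + 1) = (p.run l (iter j)).setVar x (j + 1) := by
      simp only [iter, Function.iterate_succ_apply']
      rw [run_var_of_notMem l _ hx]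
      exact congrArg (fun n => (p.run l (iter j)).setVar x (n + 1)) hcounter
    rw [hstep]
    refine ⟨by simp, fun y hy => ?_, fun a ha => ?_, succ j _ hj hcounter hvar harr hinv⟩
    · rw [← hvar y hy, Store.setVar_var, if_neg (List.ne_of_not_mem_cons hy),
        run_var_of_notMem l _ (List.not_mem_of_not_mem_cons hy)]
    · rw [← harr a ha, Store.setVar_arr, run_arr_of_notMem l _ ha]

end ForProg

end RAM

/-! ### Translation to machine programs -/

namespace RAM

open Polynomial

variable {V A : Type*}

/-- The register of a variable. Register `0` is left to the length of the input. -/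
noncomputable def varReg [Fintype V] (x : V) : ℕ := Fintype.equivFin V x + 1

theorem varReg_injective [Fintype V] : Function.Injective (varReg : V → ℕ) := fun _ _ h =>
  (Fintype.equivFin V).injective (Fin.val_injective (Nat.succ_injective h))

/-- The address of an array entry relative to the end of the input; the arrays are interleaved. -/
noncomputable def arrOffset [Fintype A] (a : A) (i : ℕ) : ℕ :=
  Fintype.card A * i + Fintype.equivFin A a

theorem arrOffset_inj [Fintype A] {a b : A} {i j : ℕ} :
    arrOffset a i = arrOffset b j ↔ a = b ∧ i = j := by
  refine ⟨fun h => ?_, fun ⟨hab, hij⟩ => by rw [hab, hij]⟩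
  have ha := (Fintype.equivFin A a).isLt
  have hdiv : i = j := by
    have hb := (Fintype.equivFin A b).isLt
    simpa [arrOffset, Nat.mul_add_div (Nat.zero_lt_of_lt ha), Nat.div_eq_of_lt ha,
      Nat.div_eq_of_lt hb] using congrArg (· / Fintype.card A) h
  refine ⟨(Fintype.equivFin A).injective (Fin.val_injective ?_), hdiv⟩
  simpa [arrOffset, hdiv] using h

section

variable [Fintype V] [Fintype A]

/-- The machine expression for the address of an array entry. -/
noncomputable def arrAddress (a : A) (i : Expr) : Expr :=
  .bin .add (.reg 0)
    (.bin .add (.bin .mul (.lit (Fintype.card A)) i) (.lit (Fintype.equivFin A a)))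

/-- Translation of expressions. As `a - (a + 1 - n) = min a (n - 1)` for positive `n`, the machine
never reads past an input of length `n`. -/
noncomputable def ForExpr.compile : ForExpr V A → Expr
  | .lit k => .lit k
  | .var x => .reg (varReg x)
  | .input e =>
      .load (.bin .sub e.compile (.bin .sub (.bin .add e.compile (.lit 1)) (.reg 0)))
  | .arr a e => .load (arrAddress a e.compile)
  | .bin o e₁ e₂ => .bin o e₁.compile e₂.compile

/-- Translation of programs. -/
noncomputable def ForProg.compile : ForProg V A → Prog
  | .skip => .skip
  | .set x e => .assign (varReg x) e.compile
  | .store a i e => .store (arrAddress a i.compile) e.compile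
  | .seq p q => .seq p.compile q.compile
  | .ite e p q => .ite e.compile p.compile q.compile
  | .upTo x k p =>
      .seq (.assign (varReg x) (.lit 0))
        (.loop (ForExpr.input (.lit k) - .var x : ForExpr V A).compile
          (.seq p.compile (.assign (varReg x) (.var x + 1 : ForExpr V A).compile)))

/-- The machine state `s` represents the input `l` and the store `h`. -/
structure Represents (l : List ℕ) (h : Store V A) (s : State) : Prop where
  length : s.reg 0 = l.length
  var : ∀ x, s.reg (varReg x) = h.var x
  input : ∀ i < l.length, s.mem i = l.getD i 0
  arr : ∀ a i, s.mem (l.length + arrOffset a i) = h.arr a i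

namespace Represents

variable {l : List ℕ} {h : Store V A} {s : State}

theorem eval_arrAddress (hs : Represents l h s) (a : A) (i : Expr) :
    (arrAddress a i).eval s = l.length + arrOffset a (i.eval s) := by
  simp only [arrAddress, Expr.eval, Op.eval, hs.length, arrOffset]

theorem eval_compile (hs : Represents l h s) (hl : 0 < l.length) (e : ForExpr V A) :
    e.compile.eval s = e.eval l h := by
  induction e with
  | lit k => rfl
  | var x => exact hs.var x
  | input e ih =>
    have hmin : e.eval l h - (e.eval l h + 1 - l.length) = min (e.eval l h) (l.length - 1) := by
      omega
    simp only [ForExpr.compile, Expr.eval, Op.eval, ih, hs.length, ForExpr.eval_input, hmin]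
    exact hs.input _ (by omega)
  | arr a e ih =>
    simp only [ForExpr.compile, Expr.eval, hs.eval_arrAddress, ih, ForExpr.eval_arr]
    exact hs.arr a _
  | bin o e₁ e₂ h₁ h₂ => simp only [ForExpr.compile, Expr.eval, ForExpr.eval, h₁, h₂]

theorem setVar [DecidableEq V] (hs : Represents l h s) (x : V) (k : ℕ) :
    Represents l (h.setVar x k) (s.setReg (varReg x) k) where
  length := by
    rw [← hs.length]
    exact Function.update_of_ne (Nat.succ_ne_zero (Fintype.equivFin V x)).symm k s.reg
  var y := by
    simp only [State.setReg, Function.update_apply, varReg_injective.eq_iff, hs.var,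
      Store.setVar_var]
  input := hs.input
  arr := hs.arr

theorem setArr [DecidableEq A] (hs : Represents l h s) (a : A) (i k : ℕ) :
    Represents l (h.setArr a i k) (s.setMem (l.length + arrOffset a i) k) where
  length := hs.length
  var := hs.var
  input j hj := by
    rw [← hs.input j hj]
    exact Function.update_of_ne (hj.trans_le (Nat.le_add_right _ (arrOffset a i))).ne k s.mem
  arr b j := by
    simp only [State.setMem, Function.update_apply, add_right_inj, arrOffset_inj, hs.arr,
      Store.setArr_arr]
    by_cases hba : b = a <;> simp [hba, Function.update_apply]

end Represents

/-! ### Running times of translated programs -/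

/-- The machine program `q` carries out `f` on every store represented with numbers of length at
most `L`, within time `τ * (L + g)` and creating only numbers of length at most `L + g`. -/
def Simulates (l : List ℕ) (g τ : ℕ) (q : Prog) (f : Store V A → Store V A) : Prop :=
  ∀ h s L, 0 < L → Represents l h s → s.Bounded L →
    ∃ t s', Exec q s t s' ∧ Represents l (f h) s' ∧ s'.Bounded (L + g) ∧ t ≤ τ * (L + g)

/-- Expressions that lengthen the numbers they are computed from by no more than a constant
multiple of the length of the input entries. -/
def ForExpr.tame : ForExpr V A → Bool
  | .bin .add e₁ e₂ => e₁.tame && e₂.tame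
  | .bin .sub e _ => e.tame
  | .bin .div e _ => e.tame
  | .bin .mul e (.input _) => e.tame
  | .bin .mul _ _ => false
  | _ => true

theorem ForExpr.exists_len_eval_le_of_tame {e : ForExpr V A} (he : e.tame = true) :
    ∃ c, ∀ (l : List ℕ) (N : ℕ) (h : Store V A) (s : State) (L : ℕ), 0 < l.length →
      (∀ x ∈ l, len x ≤ N) → Represents l h s → s.Bounded L → len (e.eval l h) ≤ L + c * N := by
  induction e with
  | lit k =>
    refine ⟨len k, fun l N h s L hl hN _ _ => ?_⟩
    have hN0 : 0 < N := (len_pos _).trans_le (hN _ (readInput_mem hl 0))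
    exact (Nat.le_mul_of_pos_right (len k) hN0).trans (Nat.le_add_left _ _)
  | var x => exact ⟨0, fun l N h s L _ _ hs hL => by simpa [← hs.var] using hL.1 _⟩
  | input e =>
    refine ⟨1, fun l N h s L hl hN _ _ => ?_⟩
    have := hN _ (readInput_mem hl (e.eval l h))
    rw [eval_input]
    omega
  | arr a e => exact ⟨0, fun l N h s L _ _ hs hL => by simpa [← hs.arr] using hL.2 _⟩
  | bin o e₁ e₂ h₁ h₂ =>
    cases o with
    | add =>
      simp only [tame, Bool.and_eq_true] at he
      obtain ⟨c₁, h₁⟩ := h₁ he.1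
      obtain ⟨c₂, h₂⟩ := h₂ he.2
      refine ⟨c₁ + c₂ + 1, fun l N h s L hl hN hs hL => ?_⟩
      have hN0 : 0 < N := (len_pos _).trans_le (hN _ (readInput_mem hl 0))
      have h₁ := h₁ l N h s L hl hN hs hL
      have h₂ := h₂ l N h s L hl hN hs hL
      have := len_add_le_max (e₁.eval l h) (e₂.eval l h)
      simp only [eval, Op.eval, add_mul, one_mul]
      omega
    | sub =>
      obtain ⟨c, h₁⟩ := h₁ he
      exact ⟨c, fun l N h s L hl hN hs hL =>
        (len_mono (Nat.sub_le _ _)).trans (h₁ l N h s L hl hN hs hL)⟩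
    | div =>
      obtain ⟨c, h₁⟩ := h₁ he
      exact ⟨c, fun l N h s L hl hN hs hL =>
        (len_mono (Nat.div_le_self _ _)).trans (h₁ l N h s L hl hN hs hL)⟩
    | mul =>
      cases e₂ with
      | input e =>
        obtain ⟨c, h₁⟩ := h₁ he
        refine ⟨c + 1, fun l N h s L hl hN hs hL => ?_⟩
        have h₁ := h₁ l N h s L hl hN hs hL
        have h₂ := hN _ (readInput_mem hl (e.eval l h))
        have := len_mul_le (e₁.eval l h) (readInput l (e.eval l h))
        simp only [eval, Op.eval, add_mul, one_mul]
        omega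
      | _ => simp [tame] at he

namespace Simulates

variable {l : List ℕ} {g g₁ g₂ τ τ₁ τ₂ : ℕ} {q q₁ q₂ : Prog} {f f₁ f₂ : Store V A → Store V A}

theorem mono (hq : Simulates l g₁ τ₁ q f) (hg : g₁ ≤ g₂) (hτ : τ₁ ≤ τ₂) :
    Simulates l g₂ τ₂ q f := by
  intro h s L hL hs hb
  obtain ⟨t, s', hexec, hs', hb', ht⟩ := hq h s L hL hs hb
  exact ⟨t, s', hexec, hs', hb'.mono (by omega), ht.trans (Nat.mul_le_mul hτ (by omega))⟩

protected theorem skip : Simulates l 0 1 .skip (id : Store V A → Store V A) :=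
  fun _ s _ hL hs hb => ⟨1, s, .skip s, hs, hb, by omega⟩

protected theorem seq (h₁ : Simulates l g₁ τ₁ q₁ f₁) (h₂ : Simulates l g₂ τ₂ q₂ f₂) :
    Simulates l (g₁ + g₂) (τ₁ + τ₂) (.seq q₁ q₂) (f₂ ∘ f₁) := by
  intro h s L hL hs hb
  obtain ⟨t₁, s₁, hexec₁, hs₁, hb₁, ht₁⟩ := h₁ h s L hL hs hb
  obtain ⟨t₂, s₂, hexec₂, hs₂, hb₂, ht₂⟩ := h₂ _ s₁ (L + g₁) (by omega) hs₁ hb₁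
  rw [add_assoc] at hb₂ ht₂
  refine ⟨_, s₂, .seq hexec₁ hexec₂, hs₂, hb₂, ?_⟩
  calc t₁ + t₂ ≤ τ₁ * (L + (g₁ + g₂)) + τ₂ * (L + (g₁ + g₂)) :=
        add_le_add (ht₁.trans (Nat.mul_le_mul_left _ (by omega))) ht₂
    _ = (τ₁ + τ₂) * (L + (g₁ + g₂)) := (add_mul ..).symm

protected theorem ite {e : ForExpr V A} {C : ℕ} (hl : 0 < l.length)
    (hC : e.compile.LinearCost C)
    (h₁ : Simulates l g τ₁ q₁ f₁) (h₂ : Simulates l g τ₂ q₂ f₂) :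
    Simulates l g (C + τ₁ + τ₂) (.ite e.compile q₁ q₂)
      (fun h => if e.eval l h = 0 then f₂ h else f₁ h) := by
  intro h s L hL hs hb
  have hcost := (hC s L hL hb).trans (Nat.mul_le_mul_left C (Nat.le_add_right L g))
  simp only [add_mul]
  by_cases he : e.eval l h = 0
  · obtain ⟨t, s', hexec, hs', hb', ht⟩ := h₂ h s L hL hs hb
    refine ⟨_, s', .ite_false (by rwa [hs.eval_compile hl]) hexec, ?_, hb', by omega⟩
    rwa [if_pos he]
  · obtain ⟨t, s', hexec, hs', hb', ht⟩ := h₁ h s L hL hs hb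
    refine ⟨_, s', .ite_true (by rwa [hs.eval_compile hl]) hexec, ?_, hb', by omega⟩
    rwa [if_neg he]

protected theorem assign [DecidableEq V] {e : ForExpr V A} {C : ℕ} (hl : 0 < l.length) (x : V)
    (hC : e.compile.LinearCost C)
    (hg : ∀ (h : Store V A) s L, 0 < L → Represents l h s → s.Bounded L →
      len (e.eval l h) ≤ L + g) :
    Simulates l g (C + len (varReg x)) (.assign (varReg x) e.compile)
      (fun h => h.setVar x (e.eval l h)) := by
  intro h s L hL hs hb
  refine ⟨_, _, .assign _ _ s, ?_, ?_, ?_⟩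
  · rw [hs.eval_compile hl]
    exact hs.setVar x _
  · rw [hs.eval_compile hl]
    exact (hb.mono (Nat.le_add_right L g)).setReg (hg h s L hL hs hb)
  · have hcost := (hC s L hL hb).trans (Nat.mul_le_mul_left C (Nat.le_add_right L g))
    have := Nat.le_mul_of_pos_right (len (varReg x)) (show 0 < L + g by omega)
    rw [add_mul]
    omega

protected theorem store [DecidableEq A] {i e : ForExpr V A} {C₁ C₂ : ℕ} (hl : 0 < l.length) (a : A)
    (hC₁ : (arrAddress a i.compile).LinearCost C₁)
    (hC₂ : e.compile.LinearCost C₂)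
    (hg : ∀ (h : Store V A) s L, 0 < L → Represents l h s → s.Bounded L →
      len (e.eval l h) ≤ L + g) :
    Simulates l g (C₁ + C₂) (.store (arrAddress a i.compile) e.compile)
      (fun h => h.setArr a (i.eval l h) (e.eval l h)) := by
  intro h s L hL hs hb
  refine ⟨_, _, .store _ _ s, ?_, ?_, ?_⟩
  · rw [hs.eval_arrAddress, hs.eval_compile hl, hs.eval_compile hl]
    exact hs.setArr a _ _
  · rw [hs.eval_compile hl]
    exact (hb.mono (Nat.le_add_right L g)).setMem (hg h s L hL hs hb)
  · have := (hC₁ s L hL hb).trans (Nat.mul_le_mul_left C₁ (Nat.le_add_right L g))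
    have := (hC₂ s L hL hb).trans (Nat.mul_le_mul_left C₂ (Nat.le_add_right L g))
    rw [add_mul]
    omega

protected theorem loop {e : Expr} {C n : ℕ} {x : V}
    (hC : e.LinearCost C)
    (he : ∀ (h : Store V A) s, Represents l h s → e.eval s = n - h.var x)
    (hq : Simulates l g τ q f) (hf : ∀ h, (f h).var x = h.var x + 1) (j : ℕ) :
    ∀ (h : Store V A) s L, 0 < L → n - h.var x = j → Represents l h s → s.Bounded L →
      ∃ t s', Exec (.loop e q) s t s' ∧ Represents l (f^[j] h) s' ∧ s'.Bounded (L + j * g) ∧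
        t ≤ (C * (j + 1) + τ * j) * (L + j * g) := by
  induction j with
  | zero =>
    intro h s L hL hj hs hb
    refine ⟨_, s, .loop_false (by rw [he h s hs, hj]), hs, by simpa using hb, ?_⟩
    simpa using hC s L hL hb
  | succ j ih =>
    intro h s L hL hj hs hb
    obtain ⟨t₁, s₁, hexec₁, hs₁, hb₁, ht₁⟩ := hq h s L hL hs hb
    obtain ⟨t₂, s₂, hexec₂, hs₂, hb₂, ht₂⟩ :=
      ih (f h) s₁ (L + g) (by omega) (by rw [hf]; omega) hs₁ hb₁
    have hgrowth : L + g + j * g = L + (j + 1) * g := by ring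
    rw [hgrowth] at hb₂ ht₂
    have htest : e.eval s ≠ 0 := by rw [he h s hs]; omega
    refine ⟨_, s₂, .loop_true htest hexec₁ hexec₂, hs₂, hb₂, ?_⟩
    have hcost := (hC s L hL hb).trans
      (Nat.mul_le_mul_left C (Nat.le_add_right L ((j + 1) * g)))
    have hbody := ht₁.trans
      (Nat.mul_le_mul_left τ (show L + g ≤ L + (j + 1) * g by rw [← hgrowth]; omega))
    calc e.cost s + len (e.eval s) + t₁ + t₂
        ≤ C * (L + (j + 1) * g) + τ * (L + (j + 1) * g) +
          (C * (j + 1) + τ * j) * (L + (j + 1) * g) := by omega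
      _ = (C * (j + 1 + 1) + τ * (j + 1)) * (L + (j + 1) * g) := by ring

protected theorem upTo [DecidableEq V] [DecidableEq A] {k : ℕ} {x : V} {p : ForProg V A}
    {C₁ C₂ C : ℕ} (hp : Simulates l g τ p.compile (p.run l)) (hl : 0 < l.length) (hx : x ∉ p.vars)
    (hC₁ : (ForExpr.lit 0 : ForExpr V A).compile.LinearCost C₁)
    (hC₂ : (ForExpr.var x + 1 : ForExpr V A).compile.LinearCost C₂)
    (hC : (ForExpr.input (.lit k) - .var x : ForExpr V A).compile.LinearCost C) :
    Simulates l (readInput l k * (g + 2))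
      (C₁ + len (varReg x) + (C * (readInput l k + 1) + (τ + (C₂ + len (varReg x))) *
        readInput l k)) (ForProg.upTo x k p).compile ((ForProg.upTo x k p).run l) := by
  have hzero : Simulates l 0 (C₁ + len (varReg x)) _ fun h : Store V A => h.setVar x 0 :=
    .assign hl x hC₁ fun h s L hL _ _ => hL
  have hincr : Simulates l 2 (C₂ + len (varReg x))
      (.assign (varReg x) (.var x + 1 : ForExpr V A).compile)
      fun h : Store V A => h.setVar x (h.var x + 1) := by
    refine .assign hl x hC₂ fun h s L hL hs hb => (len_add_le_max (h.var x) 1).trans ?_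
    have := hs.var x ▸ hb.1 (varReg x)
    rw [len_one]
    omega
  have htest (h : Store V A) (s : State) (hs : Represents l h s) :
      (ForExpr.input (.lit k) - .var x : ForExpr V A).compile.eval s = readInput l k - h.var x :=
    hs.eval_compile hl _
  intro h s L hL hs hb
  obtain ⟨t₁, s₁, hexec₁, hs₁, hb₁, ht₁⟩ := hzero h s L hL hs hb
  obtain ⟨t₂, s₂, hexec₂, hs₂, hb₂, ht₂⟩ := Simulates.loop hC htest (hp.seq hincr)
    (fun h => by simp [ForProg.run_var_of_notMem l h hx]) (readInput l k) _ s₁ L hL (by simp)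
    hs₁ hb₁
  refine ⟨_, s₂, .seq hexec₁ hexec₂, hs₂, hb₂, ?_⟩
  rw [add_mul (C₁ + _)]
  exact add_le_add (ht₁.trans (Nat.mul_le_mul_left _ (Nat.add_le_add_left (Nat.zero_le _) L))) ht₂

end Simulates

namespace ForProg

/-- Syntactic conditions for polynomial running time: all stored values are tame, and no loop
changes its own loop variable. -/
def wellFormed [DecidableEq V] : ForProg V A → Bool
  | skip => true
  | set _ e => e.tame
  | store _ _ e => e.tame
  | seq p q => p.wellFormed && q.wellFormed
  | ite _ p q => p.wellFormed && q.wellFormed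
  | upTo x _ p => decide (x ∉ p.vars) && p.wellFormed

/-- The positions of the input entries that serve as loop bounds. -/
def bounds : ForProg V A → List ℕ
  | skip => []
  | set _ _ => []
  | store _ _ _ => []
  | seq p q => p.bounds ++ q.bounds
  | ite _ p q => p.bounds ++ q.bounds
  | upTo _ k p => k :: p.bounds

variable [DecidableEq V] [DecidableEq A]

/-- The translation of a program runs in polynomial time; `N` bounds both the lengths of the input
entries and the number of iterations of each loop. -/
def PolyTime (p : ForProg V A) : Prop :=
  ∃ g τ : ℕ[X], ∀ (l : List ℕ) (N : ℕ), 0 < l.length → (∀ x ∈ l, len x ≤ N) →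
    (∀ k ∈ p.bounds, readInput l k ≤ N) →
    Simulates l (g.eval N) (τ.eval N) p.compile (p.run l)

theorem polyTime_skip : PolyTime (skip : ForProg V A) :=
  ⟨0, 1, fun l N _ _ _ => by
    simp only [eval_zero, eval_one]
    exact .skip⟩

theorem polyTime_set (x : V) {e : ForExpr V A} (he : e.tame = true) : PolyTime (set x e) := by
  obtain ⟨C, hC⟩ := e.compile.exists_linearCost
  obtain ⟨c, hc⟩ := ForExpr.exists_len_eval_le_of_tame he
  refine ⟨(c : ℕ[X]) * X, (C + len (varReg x) : ℕ), fun l N hl hN _ => ?_⟩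
  simp only [eval_mul, eval_natCast, eval_X]
  exact Simulates.assign hl x hC fun h s L _ hs hb => hc l N h s L hl hN hs hb

theorem polyTime_store (a : A) (i : ForExpr V A) {e : ForExpr V A} (he : e.tame = true) :
    PolyTime (store a i e) := by
  obtain ⟨C₁, hC₁⟩ := (arrAddress a i.compile).exists_linearCost
  obtain ⟨C₂, hC₂⟩ := e.compile.exists_linearCost
  obtain ⟨c, hc⟩ := ForExpr.exists_len_eval_le_of_tame he
  refine ⟨(c : ℕ[X]) * X, (C₁ + C₂ : ℕ), fun l N hl hN _ => ?_⟩
  simp only [eval_mul, eval_natCast, eval_X]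
  exact Simulates.store hl a hC₁ hC₂ fun h s L _ hs hb => hc l N h s L hl hN hs hb

namespace PolyTime

variable {p q : ForProg V A}

protected theorem seq (hp : p.PolyTime) (hq : q.PolyTime) : PolyTime (p ;; q) := by
  obtain ⟨g₁, τ₁, hp⟩ := hp
  obtain ⟨g₂, τ₂, hq⟩ := hq
  refine ⟨g₁ + g₂, τ₁ + τ₂, fun l N hl hN hbounds => ?_⟩
  simp only [bounds, List.forall_mem_append] at hbounds
  simp only [eval_add]
  exact (hp l N hl hN hbounds.1).seq (hq l N hl hN hbounds.2)

protected theorem ite (e : ForExpr V A) (hp : p.PolyTime) (hq : q.PolyTime) :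
    PolyTime (ite e p q) := by
  obtain ⟨C, hC⟩ := e.compile.exists_linearCost
  obtain ⟨g₁, τ₁, hp⟩ := hp
  obtain ⟨g₂, τ₂, hq⟩ := hq
  refine ⟨g₁ + g₂, (C : ℕ[X]) + τ₁ + τ₂, fun l N hl hN hbounds => ?_⟩
  simp only [bounds, List.forall_mem_append] at hbounds
  simp only [eval_add, eval_natCast]
  exact .ite hl hC ((hp l N hl hN hbounds.1).mono (Nat.le_add_right ..) le_rfl)
    ((hq l N hl hN hbounds.2).mono (Nat.le_add_left ..) le_rfl)

protected theorem upTo {x : V} (hx : x ∉ p.vars) (k : ℕ) (hp : p.PolyTime) :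
    PolyTime (upTo x k p) := by
  obtain ⟨C₁, hC₁⟩ := (ForExpr.lit 0 : ForExpr V A).compile.exists_linearCost
  obtain ⟨C₂, hC₂⟩ := (ForExpr.var x + 1 : ForExpr V A).compile.exists_linearCost
  obtain ⟨C, hC⟩ := (ForExpr.input (.lit k) - .var x : ForExpr V A).compile.exists_linearCost
  obtain ⟨g, τ, hp⟩ := hp
  refine ⟨X * (g + 2), ((C₁ + len (varReg x) : ℕ) : ℕ[X]) + ((C : ℕ[X]) * (X + 1) +
    (τ + ((C₂ + len (varReg x) : ℕ) : ℕ[X])) * X), fun l N hl hN hbounds => ?_⟩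
  obtain ⟨hk, hbounds⟩ := List.forall_mem_cons.1 hbounds
  simp only [eval_add, eval_mul, eval_natCast, eval_X, eval_one, eval_ofNat, Nat.cast_id]
  exact ((hp l N hl hN hbounds).upTo hl hx hC₁ hC₂ hC).mono (by gcongr) (by gcongr)

end PolyTime

theorem polyTime_of_wellFormed {p : ForProg V A} (hp : p.wellFormed = true) : p.PolyTime := by
  induction p with
  | skip => exact polyTime_skip
  | set x e => exact polyTime_set x hp
  | store a i e => exact polyTime_store a i hp
  | seq p q ihp ihq =>
    simp only [wellFormed, Bool.and_eq_true] at hp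
    exact (ihp hp.1).seq (ihq hp.2)
  | ite e p q ihp ihq =>
    simp only [wellFormed, Bool.and_eq_true] at hp
    exact (ihp hp.1).ite e (ihq hp.2)
  | upTo x k p ih =>
    simp only [wellFormed, Bool.and_eq_true, decide_eq_true_eq] at hp
    exact (ih hp.2).upTo hp.1 k

end ForProg

theorem represents_init (l : List ℕ) :
    Represents l (Store.zero : Store V A) ((init l).setReg 0 l.length) where
  length := by simp [State.setReg]
  var x := Function.update_of_ne (Nat.succ_ne_zero (Fintype.equivFin V x)) l.length _
  input _ _ := rfl
  arr _ _ := List.getD_eq_default _ _ (Nat.le_add_right ..)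

end

theorem solvableInPolyTime_of_wellFormed {α : Type} {enc : α → List ℕ} {D Q : α → Prop}
    [Finite V] [DecidableEq V] [Finite A] [DecidableEq A] {p : ForProg V A}
    (hp : p.wellFormed = true) (answer : V)
    (base : Expr) (hpos : ∀ a, D a → 0 < (enc a).length)
    (hbase : ∀ a, D a → base.eval (init (enc a)) = (enc a).length)
    (hbounds : ∀ a, D a → ∀ k ∈ p.bounds, readInput (enc a) k ≤ (enc a).length)
    (hyes : ∀ a, D a → Q a → (p.run (enc a) .zero).var answer = 1)
    (hno : ∀ a, D a → ¬ Q a → (p.run (enc a) .zero).var answer = 0) :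
    SolvableInPolyTime enc D Q := by
  cases nonempty_fintype V
  cases nonempty_fintype A
  obtain ⟨C₁, hC₁⟩ := base.exists_linearCost
  obtain ⟨C₂, hC₂⟩ := (Expr.reg (varReg answer)).exists_linearCost
  obtain ⟨g, τ, hrun⟩ := ForProg.polyTime_of_wellFormed hp
  let L : ℕ[X] := ((C₁ + 1 : ℕ) : ℕ[X]) * X
  refine ⟨.seq (.assign 0 base) (.seq p.compile (.assign 0 (.reg (varReg answer)))),
    L + 1 + (τ * (L + g) + ((C₂ : ℕ[X]) * (L + g) + 1)), fun a ha => ?_⟩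
  set N := inputSize (enc a)
  have hN : 0 < N := (hpos a ha).trans_le (length_le_inputSize _)
  have hstart := hC₁ _ N hN (bounded_init (hpos a ha))
  have hLN : L.eval N = C₁ * N + N := by simp [L, add_mul]
  have hb₁ : ((init (enc a)).setReg 0 (enc a).length).Bounded (L.eval N) := by
    refine ((bounded_init (hpos a ha)).mono (by omega)).setReg ?_
    rw [← hbase a ha]
    omega
  obtain ⟨t₂, s₂, hexec₂, hs₂, hb₂, ht₂⟩ :=
    hrun (enc a) N (hpos a ha) (fun x hx => len_le_inputSize hx)
      (fun k hk => (hbounds a ha k hk).trans (length_le_inputSize _)) .zero _ _ (by omega)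
      (represents_init (enc a)) hb₁
  refine ⟨_, _, .seq (.assign 0 base _) (.seq (hbase a ha ▸ hexec₂) (.assign 0 _ s₂)), ?_, ?_, ?_⟩
  · have := hC₂ s₂ _ (by omega) hb₂
    simp only [eval_add, eval_mul, eval_natCast, eval_one, len_zero, Nat.cast_id] at this ht₂ ⊢
    omega
  · exact fun hQ => by simp [State.setReg, Expr.eval, hs₂.var, hyes a ha hQ]
  · exact fun hQ => by simp [State.setReg, Expr.eval, hs₂.var, hno a ha hQ]

end RAM

/-! ### Matchings between players and items -/

namespace ItemMatching

variable {ι α : Type*} {wants : ι → α → Prop} {holds : ι → Option α} {S T : Finset α}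

open Classical in
/-- The items of `S` that are wanted by players in `D` only. -/
noncomputable def captured (wants : ι → α → Prop) (D : Finset ι) (S : Finset α) : Finset α :=
  {w ∈ S | ∀ j, wants j w → j ∈ D}

theorem mem_captured {D : Finset ι} {w : α} :
    w ∈ captured wants D S ↔ w ∈ S ∧ ∀ j, wants j w → j ∈ D := by
  simp [captured]

theorem captured_mono {D D' : Finset ι} (hD : D ⊆ D') (hS : S ⊆ T) :
    captured wants D S ⊆ captured wants D' T := fun w hw => by
  rw [mem_captured] at hw ⊢
  exact ⟨hS hw.1, fun j hj => hD (hw.2 j hj)⟩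

/-- Hall's condition for assigning the items of `S` to distinct players who want them. -/
def HallCondition (wants : ι → α → Prop) (S : Finset α) : Prop :=
  ∀ D : Finset ι, (captured wants D S).card ≤ D.card

/-- Each player holds at most one item, which the player wants, and `S` is the set of the items
held. -/
structure IsMatching (wants : ι → α → Prop) (holds : ι → Option α) (S : Finset α) : Prop where
  wants : ∀ i w, holds i = some w → wants i w
  inj : ∀ i j w, holds i = some w → holds j = some w → i = j
  mem_iff : ∀ w, w ∈ S ↔ ∃ i, holds i = some w

protected theorem IsMatching.empty : IsMatching wants (fun _ => none) ∅ :=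
  ⟨by simp, by simp, by simp⟩

theorem IsMatching.of_injOn [DecidableEq ι] [DecidableEq α] {D : Finset ι} {w : ι → α}
    (hw : ∀ i ∈ D, wants i (w i)) (hinj : Set.InjOn w D) :
    IsMatching wants (fun i => if i ∈ D then some (w i) else none) (D.image w) where
  wants i v hv := by
    simp only [Option.ite_none_right_eq_some, Option.some_inj] at hv
    exact hv.2 ▸ hw i hv.1
  inj i j v hi hj := by
    simp only [Option.ite_none_right_eq_some, Option.some_inj] at hi hj
    exact hinj hi.1 hj.1 (hi.2.trans hj.2.symm)
  mem_iff v := by simp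

theorem IsMatching.card_eq [Fintype ι] (h : IsMatching wants holds S) :
    S.card = Finset.card {i | (holds i).isSome} := by
  refine (Finset.card_bij (fun i hi => (holds i).get (Finset.mem_filter_univ i |>.1 hi))
    (fun i hi => ?_) (fun i hi j hj hij => ?_) fun w hw => ?_).symm
  · exact (h.mem_iff _).2 ⟨i, (Option.some_get _).symm⟩
  · exact h.inj i j _ (Option.some_get _).symm (by rw [hij, Option.some_get])
  · obtain ⟨i, hi⟩ := (h.mem_iff w).1 hw
    exact ⟨i, by simp [hi], by simp [hi]⟩

theorem IsMatching.hallCondition (h : IsMatching wants holds S) : HallCondition wants S := by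
  intro D
  choose holder hholder using fun w : captured wants D S =>
    (h.mem_iff w).1 (mem_captured.1 w.2).1
  rw [← Fintype.card_coe, ← Fintype.card_coe]
  refine Fintype.card_le_of_injective
    (fun w => ⟨holder w, (mem_captured.1 w.2).2 _ (h.wants _ w (hholder w))⟩) fun w w' heq => ?_
  have hw := hholder w
  rw [Subtype.mk.inj heq, hholder w'] at hw
  exact Subtype.ext (Option.some_injective _ hw).symm

/-! ### Inserting an item into a matching -/

/-- The situation while an item is being inserted into a matching: the items of `T` are held by
the players, except that one of them may be floating. The height of a player counts how often the
player received an item since the insertion began; a floating item always goes to a player of least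
height. -/
structure Insertion [Fintype ι] (wants : ι → α → Prop) (holds : ι → Option α) (height : ι → ℕ)
    (floating : Option α) (T : Finset α) : Prop where
  matching : IsMatching (fun (o : Option ι) w => ∀ i ∈ o, wants i w)
    (fun o : Option ι => o.elim floating holds) T
  height_eq_zero : ∀ i, holds i = none → height i = 0
  height_le_succ : ∀ i w j, holds i = some w → wants j w → height i ≤ height j + 1
  height_le : ∀ i, height i ≤ Fintype.card ι

theorem exists_lt_card_forall_ne [Fintype ι] {f : ι → ℕ} {i₀ : ι} (h : Fintype.card ι ≤ f i₀) :
    ∃ g < Fintype.card ι, ∀ i, f i ≠ g := by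
  classical
  obtain ⟨g, hg, hgap⟩ :
      ∃ g ∈ Finset.range (Fintype.card ι), g ∉ (Finset.univ.erase i₀).image f := by
    refine Finset.exists_mem_notMem_of_card_lt_card (Finset.card_image_le.trans_lt ?_)
    rw [Finset.card_range]
    exact Finset.card_erase_lt_of_mem (Finset.mem_univ i₀)
  rw [Finset.mem_range] at hg
  refine ⟨g, hg, fun i hi => hgap (Finset.mem_image.2 ⟨i, ?_, hi⟩)⟩
  refine Finset.mem_erase.2 ⟨?_, Finset.mem_univ i⟩
  rintro rfl
  omega

namespace Insertion

variable [Fintype ι] {height : ι → ℕ} {floating : Option α}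

theorem start [DecidableEq α] (h : IsMatching wants holds S) {v : α} (hv : v ∉ S) :
    Insertion wants holds (fun _ => 0) (some v) (insert v S) where
  matching := by
    have hfresh (i : ι) (hi : holds i = some v) : False := hv ((h.mem_iff v).2 ⟨i, hi⟩)
    refine ⟨?_, ?_, fun w => ?_⟩
    · rintro (_ | i) w hw
      · simp
      · simpa using h.wants i w hw
    · rintro (_ | i) (_ | j) w hi hj
      · rfl
      · exact (hfresh j (hj.trans hi.symm)).elim
      · exact (hfresh i (hi.trans hj.symm)).elim
      · exact congrArg some (h.inj i j w hi hj)
    · simp [Option.exists, h.mem_iff, eq_comm]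
  height_eq_zero _ _ := rfl
  height_le_succ _ _ _ _ _ := Nat.zero_le _
  height_le _ := Nat.zero_le _

theorem isMatching (h : Insertion wants holds height none T) : IsMatching wants holds T where
  wants i w hi := h.matching.wants (some i) w hi i rfl
  inj i j w hi hj := Option.some_injective _ (h.matching.inj (some i) (some j) w hi hj)
  mem_iff w := by simp [h.matching.mem_iff, Option.exists]

variable {w : α}

/-- Giving the floating item to the player `b` swaps the possessions of `b` and of nobody. -/
theorem matching_update [DecidableEq ι] (h : Insertion wants holds height (some w) T) {b : ι}
    (hb : wants b w) :
    IsMatching (fun (o : Option ι) w => ∀ i ∈ o, wants i w)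
      (fun o : Option ι => o.elim (holds b) (Function.update holds b (some w))) T := by
  have hswap (o : Option ι) : o.elim (holds b) (Function.update holds b (some w)) =
      (Equiv.swap none (some b) o).elim (some w) holds := by
    rcases o with _ | i
    · simp
    · by_cases hib : i = b
      · simp [hib]
      · simp [hib, Equiv.swap_apply_of_ne_of_ne]
  refine ⟨?_, fun o p v ho hp => ?_, fun v => ?_⟩
  · rintro (_ | i) v hv
    · simp
    · by_cases hib : i = b
      · subst hib
        simpa [show v = w by simpa [eq_comm] using hv] using hb
      · exact h.matching.wants (some i) v (by simpa [hib] using hv)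
  · rw [hswap] at ho hp
    exact (Equiv.swap none (some b)).injective (h.matching.inj _ _ v ho hp)
  · simp only [h.matching.mem_iff, hswap]
    exact (Equiv.swap none (some b)).surjective.exists

theorem update [DecidableEq ι] (h : Insertion wants holds height (some w) T) {b : ι}
    (hb : wants b w) (hlt : height b < Fintype.card ι)
    (hmin : ∀ j, wants j w → height b ≤ height j) :
    Insertion wants (Function.update holds b (some w)) (Function.update height b (height b + 1))
      (holds b) T where
  matching := h.matching_update hb
  height_eq_zero i hi := by
    by_cases hib : i = b
    · simp [hib] at hi
    · simpa [hib] using h.height_eq_zero i (by simpa [hib] using hi)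
  height_le_succ i v j hi hj := by
    have hgrow : height j ≤ Function.update height b (height b + 1) j := by
      by_cases hjb : j = b <;> simp [hjb]
    refine le_trans ?_ (Nat.succ_le_succ hgrow)
    by_cases hib : i = b
    · obtain rfl : v = w := by simpa [hib, eq_comm] using hi
      simpa [hib] using hmin j hj
    · simpa [hib] using h.height_le_succ i v j (by simpa [hib] using hi) hj
  height_le i := by
    by_cases hib : i = b
    · simpa [hib] using hlt
    · simpa [hib] using h.height_le i

/-- By `height_le_succ` and since no player has height `g`, the items held above height `g` are
wanted above height `g` only; with the floating item they outnumber the players above `g`. -/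
theorem card_lt_of_gap (h : Insertion wants holds height (some w) T) {g : ℕ}
    (hgap : ∀ j, height j ≠ g) (hw : ∀ j, wants j w → g < height j) :
    ({i | g < height i} : Finset ι).card <
      (captured wants ({i | g < height i} : Finset ι) T).card := by
  set D : Finset ι := {i | g < height i}
  have hD (i : ι) : i ∈ D ↔ g < height i := by simp [D]
  have hex : ∀ o ∈ D.insertNone, ∃ v ∈ captured wants D T, o.elim (some w) holds = some v := by
    rintro (_ | i) hi
    · exact ⟨w, mem_captured.2 ⟨(h.matching.mem_iff w).2 ⟨none, rfl⟩, by simpa [hD] using hw⟩, rfl⟩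
    · rw [Finset.some_mem_insertNone, hD] at hi
      have hholds : holds i ≠ none := fun hnone => by
        rw [h.height_eq_zero i hnone] at hi
        exact absurd hi (Nat.not_lt_zero g)
      obtain ⟨v, hv⟩ := Option.ne_none_iff_exists'.1 hholds
      refine ⟨v, mem_captured.2 ⟨(h.matching.mem_iff v).2 ⟨some i, hv⟩, fun j hj => ?_⟩, hv⟩
      have := h.height_le_succ i v j hv hj
      have := hgap j
      rw [hD]
      omega
  have : Nonempty α := ⟨w⟩
  choose! item hcaptured hitem using hex
  rw [← Nat.succ_le_iff, Nat.succ_eq_add_one, ← Finset.card_insertNone]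
  refine Finset.card_le_card_of_injOn item hcaptured fun o ho p hp heq => ?_
  exact h.matching.inj o p _ (hitem o ho) (heq ▸ hitem p hp)

theorem exists_card_lt_of_stuck (h : Insertion wants holds height (some w) T)
    (hstuck : ∀ j, wants j w → Fintype.card ι ≤ height j) :
    ∃ D : Finset ι, D.card < (captured wants D T).card := by
  suffices ∃ g, (∀ j, height j ≠ g) ∧ ∀ j, wants j w → g < height j by
    obtain ⟨g, hgap, hw⟩ := this
    exact ⟨_, h.card_lt_of_gap hgap hw⟩
  by_cases hno : ∃ j, wants j w
  · obtain ⟨j, hj⟩ := hno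
    obtain ⟨g, hg, hgap⟩ := exists_lt_card_forall_ne (hstuck j hj)
    exact ⟨g, hgap, fun i hi => hg.trans_le (hstuck i hi)⟩
  · exact ⟨Fintype.card ι + 1, fun j => (Nat.lt_succ_of_le (h.height_le j)).ne,
      fun j hj => (hno ⟨j, hj⟩).elim⟩

end Insertion

/-! ### Greedy choice of cheap items -/

/-- The items of `X` have been offered, and those of `S` have been chosen. For each cost `θ` some
set `D` of players certifies that the chosen items of cost at most `θ` cannot be extended to a
larger set satisfying Hall's condition by offered items of cost at most `θ`. -/
structure IsGreedy {β : Type*} [LinearOrder β] (wants : ι → α → Prop) (cost : α → β)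
    (X S : Finset α) : Prop where
  subset : S ⊆ X
  cert : ∀ θ, ∃ D : Finset ι, (∀ w ∈ X, w ∉ S → cost w ≤ θ → ∀ j, wants j w → j ∈ D) ∧
    D.card ≤ (captured wants D {w ∈ S | cost w ≤ θ}).card

theorem captured_union_card_ge [DecidableEq ι] (hS : HallCondition wants S) {D D' : Finset ι}
    (hD : D.card ≤ (captured wants D S).card) (hD' : D'.card ≤ (captured wants D' S).card) :
    (D ∪ D').card ≤ (captured wants (D ∪ D') S).card := by
  classical
  have hunion : captured wants D S ∪ captured wants D' S ⊆ captured wants (D ∪ D') S :=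
    Finset.union_subset (captured_mono Finset.subset_union_left subset_rfl)
      (captured_mono Finset.subset_union_right subset_rfl)
  have hinter : captured wants D S ∩ captured wants D' S ⊆ captured wants (D ∩ D') S := by
    intro w hw
    simp only [Finset.mem_inter, mem_captured] at hw ⊢
    exact ⟨hw.1.1, fun j hj => ⟨hw.1.2 j hj, hw.2.2 j hj⟩⟩
  have := Finset.card_le_card hunion
  have := (Finset.card_le_card hinter).trans (hS (D ∩ D'))
  have := Finset.card_union_add_card_inter (captured wants D S) (captured wants D' S)
  have := Finset.card_union_add_card_inter D D'
  omega

theorem HallCondition.of_card_lt_captured_insert [DecidableEq α] (hS : HallCondition wants S)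
    {v : α} {D : Finset ι} (hD : D.card < (captured wants D (insert v S)).card) :
    (∀ j, wants j v → j ∈ D) ∧ D.card ≤ (captured wants D S).card := by
  have hsub : captured wants D (insert v S) ⊆ insert v (captured wants D S) := by
    intro w hw
    rw [mem_captured, Finset.mem_insert] at hw
    rw [Finset.mem_insert, mem_captured]
    tauto
  constructor
  · by_contra hv
    refine absurd (hS D) (not_le.2 (hD.trans_le (Finset.card_le_card fun w hw => ?_)))
    refine (Finset.mem_insert.1 (hsub hw)).resolve_left ?_
    rintro rfl
    exact hv (mem_captured.1 hw).2
  · have := (Finset.card_le_card hsub).trans (Finset.card_insert_le _ _)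
    omega

namespace IsGreedy

variable {β : Type*} [LinearOrder β] {cost : α → β} {X : Finset α}

protected theorem empty : IsGreedy wants cost ∅ ∅ :=
  ⟨subset_rfl, fun _ => ⟨∅, by simp, by simp⟩⟩

theorem accept [DecidableEq α] (h : IsGreedy wants cost X S) (v : α) :
    IsGreedy wants cost (insert v X) (insert v S) := by
  refine ⟨Finset.insert_subset_insert v h.subset, fun θ => ?_⟩
  obtain ⟨D, hrejected, hcard⟩ := h.cert θ
  refine ⟨D, fun w hw hwS => ?_, hcard.trans (Finset.card_le_card (captured_mono subset_rfl ?_))⟩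
  · rw [Finset.mem_insert, not_or] at hwS
    exact hrejected w (Finset.mem_of_mem_insert_of_ne hw hwS.1) hwS.2
  · exact Finset.filter_subset_filter _ (Finset.subset_insert v S)

theorem reject [DecidableEq α] (h : IsGreedy wants cost X S) (hS : HallCondition wants S) {v : α}
    (hle : ∀ w ∈ X, cost w ≤ cost v)
    (hv : ∃ D : Finset ι, D.card < (captured wants D (insert v S)).card) :
    IsGreedy wants cost (insert v X) S := by
  classical
  refine ⟨h.subset.trans (Finset.subset_insert v X), fun θ => ?_⟩
  obtain ⟨D, hrejected, hcard⟩ := h.cert θ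
  by_cases hθ : cost v ≤ θ
  · obtain ⟨D', hD'⟩ := hv
    obtain ⟨hvD', hcard'⟩ := hS.of_card_lt_captured_insert hD'
    rw [Finset.filter_true_of_mem fun w hw => (hle w (h.subset hw)).trans hθ] at hcard ⊢
    refine ⟨D ∪ D', fun w hw hwS hwθ j hj => ?_, captured_union_card_ge hS hcard hcard'⟩
    rcases Finset.mem_insert.1 hw with rfl | hw
    · exact Finset.mem_union_right _ (hvD' j hj)
    · exact Finset.mem_union_left _ (hrejected w hw hwS hwθ j hj)
  · refine ⟨D, fun w hw hwS hwθ => ?_, hcard⟩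
    rcases Finset.mem_insert.1 hw with rfl | hw
    · exact absurd hwθ hθ
    · exact hrejected w hw hwS hwθ

theorem card_filter_le (h : IsGreedy wants cost X S) (hT : HallCondition wants T) (hTX : T ⊆ X)
    (θ : β) : ({w ∈ T | cost w ≤ θ} : Finset α).card ≤ ({w ∈ S | cost w ≤ θ} : Finset α).card := by
  classical
  obtain ⟨D, hrejected, hcard⟩ := h.cert θ
  set Tθ : Finset α := {w ∈ T | cost w ≤ θ} with hTθ
  set Sθ : Finset α := {w ∈ S | cost w ≤ θ} with hSθ
  have hsub : Tθ \ captured wants D Tθ ⊆ Sθ \ captured wants D Sθ := by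
    intro w hw
    simp only [Finset.mem_sdiff, mem_captured, hTθ, hSθ, Finset.mem_filter] at hw ⊢
    obtain ⟨⟨hwT, hwθ⟩, hnot⟩ := hw
    have hD : ¬ ∀ j, wants j w → j ∈ D := fun hD => hnot ⟨⟨hwT, hwθ⟩, hD⟩
    refine ⟨⟨?_, hwθ⟩, fun h => hD h.2⟩
    by_contra hwS
    exact hD (hrejected w (hTX hwT) hwS hwθ)
  have hcap (U : Finset α) : (U \ captured wants D U).card + (captured wants D U).card = U.card :=
    Finset.card_sdiff_add_card_eq_card fun w hw => (mem_captured.1 hw).1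
  have hTD : (captured wants D Tθ).card ≤ D.card :=
    (Finset.card_le_card (captured_mono subset_rfl (Finset.filter_subset _ T))).trans (hT D)
  have := Finset.card_le_card hsub
  have := hcap Tθ
  have := hcap Sθ
  omega

theorem card_le (h : IsGreedy wants cost X S) (hT : HallCondition wants T) (hTX : T ⊆ X) :
    T.card ≤ S.card := by
  rcases T.eq_empty_or_nonempty with rfl | hne
  · simp
  obtain ⟨y, -, hy⟩ := T.exists_max_image cost hne
  calc T.card = ({w ∈ T | cost w ≤ cost y} : Finset α).card := by rw [Finset.filter_true_of_mem hy]
    _ ≤ ({w ∈ S | cost w ≤ cost y} : Finset α).card := h.card_filter_le hT hTX _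
    _ ≤ S.card := Finset.card_filter_le _ _

end IsGreedy

theorem sum_le_sum_of_card_filter_le {β : Type*} [AddCommMonoid β] [LinearOrder β]
    [IsOrderedAddMonoid β] {cost : α → β} (hcard : S.card = T.card)
    (h : ∀ θ, ({w ∈ T | cost w ≤ θ} : Finset α).card ≤ ({w ∈ S | cost w ≤ θ} : Finset α).card) :
    ∑ w ∈ S, cost w ≤ ∑ w ∈ T, cost w := by
  classical
  induction hk : S.card generalizing S T with
  | zero => rw [Finset.card_eq_zero.1 hk, Finset.card_eq_zero.1 (hcard.symm.trans hk)]
  | succ k ih =>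
    obtain ⟨x, hx, hxmax⟩ := S.exists_max_image cost (Finset.card_pos.1 (by omega))
    obtain ⟨y, hy, hymax⟩ := T.exists_max_image cost (Finset.card_pos.1 (by omega))
    have hxy : cost x ≤ cost y := by
      have hle := h (cost y)
      rw [Finset.filter_true_of_mem hymax, ← hcard] at hle
      have hall := Finset.eq_of_subset_of_card_le (Finset.filter_subset _ _) hle
      exact Finset.filter_eq_self.1 hall x hx
    have hSx := Finset.card_erase_of_mem hx
    have hTy := Finset.card_erase_of_mem hy
    rw [← Finset.add_sum_erase _ _ hx, ← Finset.add_sum_erase _ _ hy]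
    refine add_le_add hxy (ih (by omega) (fun θ => ?_) (by omega))
    by_cases hθ : cost x ≤ θ
    · rw [Finset.filter_true_of_mem (s := S.erase x) fun w hw =>
        (hxmax w (Finset.mem_of_mem_erase hw)).trans hθ]
      exact (Finset.card_le_card (Finset.filter_subset _ _)).trans (by omega)
    · have hxθ : x ∉ ({w ∈ S | cost w ≤ θ} : Finset α) := by simp [hθ]
      have hyθ : y ∉ ({w ∈ T | cost w ≤ θ} : Finset α) := by
        simpa [hy] using (not_le.1 hθ).trans_le hxy
      rw [Finset.filter_erase, Finset.filter_erase, Finset.erase_eq_of_notMem hxθ,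
        Finset.erase_eq_of_notMem hyθ]
      exact h θ

end ItemMatching

/-! ### Reading the encoding of an instance -/

namespace StarCFD

theorem getD_flatMap_mul_add {α β : Type*} (l : List α) (f : α → List β) {L : ℕ}
    (hf : ∀ a, (f a).length = L) {j r : ℕ} (hj : j < l.length) (hr : r < L) (b : β) :
    (l.flatMap f).getD (j * L + r) b = (f l[j]).getD r b := by
  induction l generalizing j with
  | nil => simp at hj
  | cons a l ih =>
    rw [List.flatMap_cons]
    cases j with
    | zero =>
      rw [zero_mul, zero_add, List.getD_append _ _ _ _ (by rw [hf]; exact hr)]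
      rfl
    | succ j =>
      have hpos : (j + 1) * L + r = (f a).length + (j * L + r) := by rw [hf]; ring
      rw [hpos, List.getD_append_right _ _ _ _ (Nat.le_add_right ..), Nat.add_sub_cancel_left]
      exact ih (by simpa using hj)

theorem mul_add_lt_mul {n m : ℕ} (i : Fin n) (v : Fin m) : (i : ℕ) * m + v < n * m := by
  calc (i : ℕ) * m + v < i * m + m := by omega
    _ = (i + 1) * m := by ring
    _ ≤ n * m := Nat.mul_le_mul_right m i.2

end StarCFD

namespace CFDInstance

open RAM StarCFD

variable (I : CFDInstance)

open Classical in
/-- The part of the encoding that holds the adjacency matrix. -/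
noncomputable def encodeAdj : List ℕ :=
  (List.finRange I.m).flatMap fun v =>
    (List.finRange I.m).map fun w => if I.G.Adj v w then 1 else 0

/-- The part of the encoding that holds the utilities of one player. -/
def encodeRow (i : Fin I.n) : List ℕ :=
  (List.finRange I.m).flatMap fun v => [(I.u i v).num.toNat, (I.u i v).den]

theorem encode_eq :
    I.encode = I.n :: I.m :: (I.encodeAdj ++ (List.finRange I.n).flatMap I.encodeRow) := rfl

theorem length_encodeAdj : I.encodeAdj.length = I.m * I.m := by
  simp [encodeAdj, List.length_flatMap]

theorem length_encodeRow (i : Fin I.n) : (I.encodeRow i).length = I.m * 2 := by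
  simp [encodeRow, List.length_flatMap]

theorem length_encode : I.encode.length = 2 + I.m * I.m + 2 * (I.n * I.m) := by
  simp only [encode_eq, List.length_cons, List.length_append, length_encodeAdj,
    List.length_flatMap, length_encodeRow, List.map_const', List.sum_replicate,
    List.length_finRange, smul_eq_mul]
  ring

@[simp] theorem readInput_zero : readInput I.encode 0 = I.n :=
  readInput_of_lt (by rw [length_encode]; omega)

@[simp] theorem readInput_one : readInput I.encode 1 = I.m :=
  readInput_of_lt (by rw [length_encode]; omega)

theorem readInput_adj (v w : Fin I.m) :
    readInput I.encode (2 + (v * I.m + w)) = 0 ↔ ¬ I.G.Adj v w := by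
  have hlt := mul_add_lt_mul v w
  rw [readInput_of_lt (by rw [length_encode]; omega), add_comm, encode_eq, List.getD_cons_succ,
    List.getD_cons_succ, List.getD_append _ _ _ _ (by rwa [length_encodeAdj]), encodeAdj,
    getD_flatMap_mul_add _ _ (by simp) (by simp) w.2, List.getD_eq_getElem _ _ (by simp)]
  simp

theorem readInput_utility (i : Fin I.n) (v : Fin I.m) {r : ℕ} (hr : r < 2) :
    readInput I.encode (2 + I.m * I.m + (2 * (i * I.m + v) + r)) =
      [(I.u i v).num.toNat, (I.u i v).den].getD r 0 := by
  have hlt := mul_add_lt_mul i v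
  have hpos : 2 + I.m * I.m + (2 * (i * I.m + v) + r) =
      I.encodeAdj.length + (i * (I.m * 2) + (v * 2 + r)) + 1 + 1 := by
    rw [length_encodeAdj]
    ring
  rw [readInput_of_lt (by rw [length_encode]; omega), hpos, encode_eq, List.getD_cons_succ,
    List.getD_cons_succ, List.getD_append_right _ _ _ _ (Nat.le_add_right ..),
    Nat.add_sub_cancel_left,
    getD_flatMap_mul_add _ _ I.length_encodeRow (by simp) (by omega), encodeRow,
    getD_flatMap_mul_add _ _ (by simp) (by simp) hr]
  simp

theorem utility_eq_div (i : Fin I.n) (v : Fin I.m) :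
    I.u i v = ((I.u i v).num.toNat : ℚ) / (I.u i v).den := by
  have hnum : (((I.u i v).num.toNat : ℤ) : ℚ) = (I.u i v).num := by
    rw [Int.toNat_of_nonneg (Rat.num_nonneg.2 (I.u_nonneg i v))]
  rw [← Int.cast_natCast, hnum, Rat.num_div_den]

end CFDInstance

/-! ### The algorithm -/

namespace RAM

/-- How programs represent an optional index: `0` stands for none, and `i + 1` for the index
`i`. -/
def code {n : ℕ} (o : Option (Fin n)) : ℕ := o.elim 0 fun i => i + 1

@[simp] theorem code_none {n : ℕ} : code (none : Option (Fin n)) = 0 := rfl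

@[simp] theorem code_some {n : ℕ} (i : Fin n) : code (some i) = i + 1 := rfl

theorem code_injective {n : ℕ} : Function.Injective (code (n := n)) := by
  rintro (_ | i) (_ | j) h
  all_goals simp_all [Fin.ext_iff]

/-- The result of searching for an index of least `key` among those satisfying `P`. -/
structure IsArgmin {ι β : Type*} [LE β] (P : ι → Prop) (key : ι → β) (o : Option ι) : Prop where
  isLeast : ∀ b ∈ o, P b ∧ ∀ i, P i → key b ≤ key i
  eq_none : o = none → ∀ i, ¬ P i

theorem IsArgmin.insert_lt {ι β : Type*} [Preorder β] {P : ι → Prop} {key : ι → β} {o : Option ι}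
    (h : IsArgmin P key o) {i : ι} (hi : ∀ b ∈ o, key i < key b) :
    IsArgmin (fun j => P j ∨ j = i) key (some i) := by
  refine ⟨fun b hb => ?_, by simp⟩
  obtain rfl : i = b := by simpa using hb
  refine ⟨Or.inr rfl, ?_⟩
  rintro j (hj | rfl)
  · rcases o with _ | b
    · exact absurd hj (h.eq_none rfl j)
    · exact (hi b rfl).le.trans ((h.isLeast b rfl).2 j hj)
  · exact le_rfl

theorem IsArgmin.insert_ge {ι β : Type*} [LE β] {P : ι → Prop} {key : ι → β} {b i : ι}
    (h : IsArgmin P key (some b)) (hi : key b ≤ key i) :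
    IsArgmin (fun j => P j ∨ j = i) key (some b) := by
  obtain ⟨hb, hmin⟩ := h.isLeast b rfl
  refine ⟨fun b' hb' => ?_, by simp⟩
  obtain rfl : b = b' := by simpa using hb'
  exact ⟨Or.inl hb, by rintro j (hj | rfl); exacts [hmin j hj, hi]⟩

namespace ForProg

variable {V A : Type*} [DecidableEq V] [DecidableEq A]

/-- Set the entries of an array that precede the bound `k`. -/
def fill (x : V) (k : ℕ) (a : A) (e : ForExpr V A) : ForProg V A := upTo x k (store a x e)

theorem run_fill (l : List ℕ) (h : Store V A) {x : V} {k : ℕ} {a : A} {e : ForExpr V A} {f : ℕ → ℕ}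
    (he : ∀ j h', h'.var x = j → (∀ b ≠ a, h'.arr b = h.arr b) → e.eval l h' = f j) :
    ∀ i < readInput l k, ((fill x k a e).run l h).arr a i = f i := by
  refine run_upTo_induction l h (by simp [vars]) (fun j h' => ∀ i < j, h'.arr a i = f i)
    (by simp) ?_
  rintro j h' - hx - harr ih i hi
  have hej := he j h' hx (by simpa [arrs] using harr)
  rcases Nat.lt_succ_iff_lt_or_eq.1 hi with hij | rfl
  · simpa [hx, hij.ne] using ih i hij
  · simp [hx, hej]

/-- Search for an index below entry `k` of the input which passes the test `guard`. The index found
so far, stored in `best`, is replaced if the index `x` passes the test `less`. -/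
def argmin (x best : V) (k : ℕ) (guard less : ForExpr V A) : ForProg V A :=
  best ::= 0 ;; upTo x k (ite (guard.and (ForExpr.lt best 1 + less)) (best ::= x + 1) skip)

theorem run_argmin {β : Type*} [LinearOrder β] (l : List ℕ) (h : Store V A) {x best : V}
    (hx : x ≠ best) {k n : ℕ} (hk : readInput l k = n) {guard less : ForExpr V A}
    {P : Fin n → Prop} {key : Fin n → β}
    (hguard : ∀ o (i : Fin n),
      guard.eval l ((h.setVar best (code (n := n) o)).setVar x i) = 0 ↔ ¬ P i)
    (hless : ∀ b i : Fin n,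
      less.eval l ((h.setVar best (code (some b))).setVar x i) = 0 ↔ ¬ key i < key b) :
    ∃ o, (argmin x best k guard less).run l h = (h.setVar best (code o)).setVar x n ∧
      IsArgmin P key o := by
  subst hk
  suffices ∃ o, (argmin x best k guard less).run l h =
        (h.setVar best (code o)).setVar x (readInput l k) ∧
      IsArgmin (fun i : Fin (readInput l k) => P i ∧ (i : ℕ) < readInput l k) key o by
    simpa only [Fin.is_lt, and_true] using this
  rw [argmin, run_seq]
  refine run_upTo_induction l _ (by simpa [vars] using hx) (fun j h' => ∃ o,
    h' = (h.setVar best (code o)).setVar x j ∧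
      IsArgmin (fun i : Fin (readInput l k) => P i ∧ (i : ℕ) < j) key o) ?_ ?_
  · exact ⟨none, rfl, by simp, by simp⟩
  rintro j h' hj - - - ⟨o, rfl, ho⟩
  obtain ⟨i, rfl⟩ : ∃ i : Fin (readInput l k), (i : ℕ) = j := ⟨⟨j, hj⟩, rfl⟩
  have hbest : ((h.setVar best (code o)).setVar x i).var best = code o := by simp [hx.symm]
  have htest : (guard.and (ForExpr.lt best 1 + less)).eval l ((h.setVar best (code o)).setVar x i)
      = 0 ↔ ¬ (P i ∧ ∀ b ∈ o, key i < key b) := by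
    rw [ForExpr.eval_and_eq_zero, hguard, ForExpr.eval_add, Nat.add_eq_zero_iff,
      ForExpr.eval_lt_eq_zero, ForExpr.eval_var, hbest, not_and_or]
    rcases o with _ | b
    · simp
    · simpa using or_congr_right (a := ¬ P i) (hless b i)
  have hstep : (fun b : Fin (readInput l k) => P b ∧ (b : ℕ) < i + 1) =
      fun b => P b ∧ (b : ℕ) < i ∨ b = i ∧ P i := by
    ext b
    rw [Nat.lt_succ_iff_lt_or_eq, ← Fin.ext_iff]
    aesop
  rw [hstep, run_ite, run_skip]
  by_cases hi : P i ∧ ∀ b ∈ o, key i < key b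
  · rw [if_neg (not_not.2 hi ∘ htest.1)]
    refine ⟨some i, ?_, by simpa only [hi.1, and_true] using ho.insert_lt hi.2⟩
    simp [Store.setVar_comm _ hx]
  · rw [if_pos (htest.2 hi), Store.setVar_setVar]
    refine ⟨o, rfl, ?_⟩
    by_cases hPi : P i
    · simp only [hPi, true_and, not_forall, not_lt] at hi
      obtain ⟨b, rfl, hle⟩ := hi
      simpa only [hPi, and_true] using ho.insert_ge hle
    · simpa only [hPi, and_false, or_false] using ho

end ForProg

end RAM

namespace StarCFD

open RAM ForProg

/-- The variables of the algorithm. The values of `best`, `partner`, `current`, `displaced` and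
`witness` represent optional indices. -/
inductive Var where
  | candidate | witness | center | owner | round | item | best | outer | inner | player
  | current | partner | displaced | numer | denom | count | answer
deriving DecidableEq

instance : Fintype Var where
  elems := {.candidate, .witness, .center, .owner, .round, .item, .best, .outer, .inner, .player,
    .current, .partner, .displaced, .numer, .denom, .count, .answer}
  complete := by rintro ⟨⟩ <;> decide

/-- The arrays of the algorithm: a mark for the items processed so far, and for each player the item
held (an optional index), a backup copy of it, and the height. -/
inductive Arr where
  | done | holding | backup | height
deriving DecidableEq

instance : Fintype Arr where
  elems := {.done, .holding, .backup, .height}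
  complete := by rintro ⟨⟩ <;> decide

section Expressions

/-- The number of players. -/
def players : ForExpr Var Arr := .input 0

/-- The number of items. -/
def items : ForExpr Var Arr := .input 1

/-- The test whether two items are adjacent. -/
def adjacent (v w : ForExpr Var Arr) : ForExpr Var Arr := .input (2 + (v * items + w))

/-- Numerator of the utility of item `v` for player `i`. -/
def num (i v : ForExpr Var Arr) : ForExpr Var Arr :=
  .input (2 + items * items + (2 * (i * items + v) + 0))

/-- Denominator of the utility of item `v` for player `i`. -/
def den (i v : ForExpr Var Arr) : ForExpr Var Arr :=
  .input (2 + items * items + (2 * (i * items + v) + 1))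

/-- The test whether player `i` values item `v` less than item `w`. -/
def cheaper (i v w : ForExpr Var Arr) : ForExpr Var Arr :=
  .lt (num i v * den i w) (num i w * den i v)

/-- The test whether item `v` alone satisfies player `i`. -/
def satisfies (v i : ForExpr Var Arr) : ForExpr Var Arr := .le (den i v) (players * num i v)

variable {I : CFDInstance} {h : Store Var Arr} {i v w : ForExpr Var Arr} {i' : Fin I.n}
  {v' w' : Fin I.m}

@[simp] theorem eval_players : players.eval I.encode h = I.n := I.readInput_zero

@[simp] theorem eval_items : items.eval I.encode h = I.m := I.readInput_one

theorem eval_adjacent_eq_zero (hv : v.eval I.encode h = v') (hw : w.eval I.encode h = w') :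
    (adjacent v w).eval I.encode h = 0 ↔ ¬ I.G.Adj v' w' := by
  rw [← I.readInput_adj]
  simp [adjacent, hv, hw]

theorem eval_num (hi : i.eval I.encode h = i') (hv : v.eval I.encode h = v') :
    (num i v).eval I.encode h = (I.u i' v').num.toNat := by
  simpa [num, hi, hv] using I.readInput_utility i' v' (r := 0) (by decide)

theorem eval_den (hi : i.eval I.encode h = i') (hv : v.eval I.encode h = v') :
    (den i v).eval I.encode h = (I.u i' v').den := by
  simpa [den, hi, hv] using I.readInput_utility i' v' (r := 1) (by decide)

theorem eval_cheaper_eq_zero (hi : i.eval I.encode h = i') (hv : v.eval I.encode h = v')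
    (hw : w.eval I.encode h = w') :
    (cheaper i v w).eval I.encode h = 0 ↔ ¬ I.u i' v' < I.u i' w' := by
  have hlt : I.u i' v' < I.u i' w' ↔
      (I.u i' v').num.toNat * (I.u i' w').den < (I.u i' w').num.toNat * (I.u i' v').den := by
    conv_lhs => rw [I.utility_eq_div i' v', I.utility_eq_div i' w']
    rw [div_lt_div_iff₀ (mod_cast Rat.den_pos _) (mod_cast Rat.den_pos _)]
    norm_cast
  rw [cheaper, ForExpr.eval_lt_eq_zero, ForExpr.eval_mul, ForExpr.eval_mul, eval_num hi hv,
    eval_num hi hw, eval_den hi hv, eval_den hi hw, hlt]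

theorem eval_satisfies_eq_zero (hi : i.eval I.encode h = i') (hv : v.eval I.encode h = v') :
    (satisfies v i).eval I.encode h = 0 ↔ ¬ 1 / (I.n : ℚ) ≤ I.u i' v' := by
  have hle : 1 / (I.n : ℚ) ≤ I.u i' v' ↔ (I.u i' v').den ≤ I.n * (I.u i' v').num.toNat := by
    conv_lhs => rw [I.utility_eq_div i' v']
    rw [div_le_div_iff₀ (mod_cast i'.pos) (mod_cast Rat.den_pos _), one_mul, mul_comm]
    norm_cast
  rw [satisfies, ForExpr.eval_le_eq_zero, ForExpr.eval_mul, eval_players, eval_num hi hv,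
    eval_den hi hv, hle]

end Expressions

/-- Find another item that is not adjacent to the candidate. -/
def findWitness : ForProg Var Arr :=
  argmin .item .witness 1
    (.and (.ne Var.item Var.candidate) (.lt (adjacent Var.candidate Var.item) 1)) 0

/-- Find an item that is adjacent to all others. -/
def findCenter : ForProg Var Arr :=
  upTo .candidate 1 (findWitness ;; ite Var.witness skip (.center ::= Var.candidate))

/-- Find an unprocessed item that is cheapest for the owner of the center. -/
def select : ForProg Var Arr :=
  argmin .item .best 1 (.lt (.arr .done Var.item) 1) (cheaper Var.owner Var.item (Var.best - 1))

/-- Find a player of least height who wants the current item. -/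
def findPartner : ForProg Var Arr :=
  argmin .player .partner 0
    (.and (.and (.ne Var.player Var.owner) (satisfies (Var.current - 1) Var.player))
      (.lt (.arr .height Var.player) players))
    (.lt (.arr .height Var.player) (.arr .height (Var.partner - 1)))

/-- Hand the current item to the partner; the item the partner held becomes current. -/
def handOver : ForProg Var Arr :=
  .displaced ::= .arr .holding (Var.partner - 1) ;;
    store .holding (Var.partner - 1) Var.current ;;
    store .height (Var.partner - 1) (.arr .height (Var.partner - 1) + 1) ;;
    .current ::= Var.displaced

/-- Unless no item is current, hand it over if possible. -/
def push : ForProg Var Arr :=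
  ite Var.current (findPartner ;; ite Var.partner handOver skip) skip

/-- The sum of the heights is at most `n * n`, so this many pushes suffice. -/
def pushAll : ForProg Var Arr := upTo .outer 0 (upTo .inner 0 push)

/-- Insert the selected item into the matching, leaving an item floating if this fails. -/
def tryInsert : ForProg Var Arr :=
  fill .player 0 .backup (.arr .holding Var.player) ;;
    fill .player 0 .height 0 ;;
    .current ::= Var.best ;;
    pushAll

/-- Return to the matching that was backed up by `tryInsert`. -/
def restore : ForProg Var Arr := fill .player 0 .holding (.arr .backup Var.player)

/-- Count the selected item, and add its utility for the owner to `numer / denom`. -/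
def record : ForProg Var Arr :=
  .numer ::= Var.numer * den Var.owner (Var.best - 1) +
      Var.denom * num Var.owner (Var.best - 1) ;;
    .denom ::= Var.denom * den Var.owner (Var.best - 1) ;;
    .count ::= Var.count + 1

/-- Offer the selected item to the matching. -/
def process : ForProg Var Arr :=
  store .done (Var.best - 1) 1 ;; tryInsert ;; ite Var.current restore record

/-- Start with the empty matching, and exclude the center from it. -/
def reset : ForProg Var Arr :=
  fill .player 0 .holding 0 ;;
    fill .item 1 .done 0 ;;
    store .done (Var.center : ForExpr Var Arr) 1 ;;
    .numer ::= 0 ;;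
    .denom ::= 1 ;;
    .count ::= 0

/-- Offer the items to the matching in order of increasing utility for the owner. -/
def greedy : ForProg Var Arr := upTo .round 1 (select ;; ite Var.best process skip)

/-- Accept if all players but the owner are matched, and the owner is satisfied with the rest. -/
def verdict : ForProg Var Arr :=
  ite (.ne (Var.count + 1) players) skip
    (ite (.le (players * Var.numer + Var.denom) (players * Var.denom)) (.answer ::= 1) skip)

/-- The algorithm tries all possible owners of the center. -/
def decideProp : ForProg Var Arr :=
  findCenter ;;
    ite players skip (.answer ::= 1) ;;
    upTo .owner 0 (reset ;; greedy ;; verdict)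

theorem wellFormed_decideProp : decideProp.wellFormed = true := by decide

end StarCFD

/-! ### Correctness of the algorithm -/

namespace StarCFD

open RAM ForProg ItemMatching

variable {I : CFDInstance}

/-- The single item `w` satisfies player `i`, and `i` is not the owner `k` of the center. -/
def Wants (I : CFDInstance) (k i : Fin I.n) (w : Fin I.m) : Prop := i ≠ k ∧ 1 / (I.n : ℚ) ≤ I.u i w

theorem run_findWitness {h : Store Var Arr} {c : Fin I.m} (hc : h.var .candidate = c) :
    (findWitness.run I.encode h).var .witness = 0 ↔ I.G.IsUniversal c := by
  obtain ⟨o, hrun, ho⟩ := run_argmin I.encode h (x := Var.item) (best := .witness) (k := 1)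
    (guard := .and (.ne Var.item Var.candidate) (.lt (adjacent Var.candidate Var.item) 1))
    (less := 0) (P := fun w => ¬ (c ≠ w → I.G.Adj c w)) (key := fun _ => 0)
    (by decide) I.readInput_one
    (fun o w => by
      have hadj := eval_adjacent_eq_zero (I := I) (v := Var.candidate) (w := Var.item)
        (h := (h.setVar .witness (code (n := I.m) o)).setVar .item w) (v' := c) (w' := w)
        (by simpa using hc) (by simp)
      rw [ForExpr.eval_and_eq_zero, ForExpr.eval_ne_eq_zero, ForExpr.eval_lt_eq_zero,
        ForExpr.eval_ofNat, Nat.lt_one_iff, hadj]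
      simp [hc, Fin.val_inj, or_iff_not_imp_left, ne_comm])
    fun b i => by simp
  rw [findWitness, hrun]
  rcases o with _ | w
  · exact iff_of_true (by simp) fun w => not_not.1 (ho.eq_none rfl w)
  · exact iff_of_false (by simp) fun hc => (ho.isLeast w rfl).1 (@hc w)

theorem run_findCenter (h : Store Var Arr) (hI : ∃ c, I.G.IsUniversal c) :
    ∃ c, I.G.IsUniversal c ∧ (findCenter.run I.encode h).var .center = c := by
  suffices (∃ c, I.G.IsUniversal c ∧ (findCenter.run I.encode h).var .center = c) ∨
      ∀ c : Fin I.m, c < readInput I.encode 1 → ¬ I.G.IsUniversal c by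
    obtain ⟨c, hc⟩ := hI
    exact this.resolve_right fun hnone => hnone c (by simp) hc
  rw [findCenter]
  refine run_upTo_induction _ _ (by decide) (fun j (h' : Store Var Arr) =>
    (∃ c, I.G.IsUniversal c ∧ h'.var .center = c) ∨ ∀ c : Fin I.m, c < j → ¬ I.G.IsUniversal c)
    (by simp) ?_
  rintro j h' hj hcandidate - - hinv
  obtain ⟨d, rfl⟩ : ∃ d : Fin I.m, (d : ℕ) = j := ⟨⟨j, by simpa using hj⟩, rfl⟩
  have hframe {x : Var} (hx : x ∉ findWitness.vars) := run_var_of_notMem I.encode h' hx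
  rw [run_seq, run_ite, ForExpr.eval_var]
  split_ifs with hwitness
  · rw [run_findWitness hcandidate] at hwitness
    exact Or.inl ⟨d, hwitness, by simp [hframe (x := .candidate) (by decide), hcandidate]⟩
  · rw [run_findWitness hcandidate] at hwitness
    rw [run_skip, Store.setVar_var, if_neg (by decide), hframe (by decide)]
    refine hinv.imp_right fun hnone c hc => ?_
    rcases Nat.lt_succ_iff_lt_or_eq.1 hc with hc | hc
    · exact hnone c hc
    · rwa [Fin.ext hc]

theorem run_select {h : Store Var Arr} {k : Fin I.n} (hk : h.var .owner = k) :
    ∃ o, select.run I.encode h = (h.setVar .best (code o)).setVar .item I.m ∧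
      IsArgmin (fun v : Fin I.m => h.arr .done v = 0) (I.u k) o := by
  refine run_argmin _ h (by decide) I.readInput_one (fun o v => ?_) fun b v => ?_
  · simp
  · exact eval_cheaper_eq_zero (by simpa using hk) (by simp) (by simp)

theorem run_findPartner {h : Store Var Arr} {k : Fin I.n} {w : Fin I.m} (hk : h.var .owner = k)
    (hw : h.var .current = code (some w)) :
    ∃ o, findPartner.run I.encode h = (h.setVar .partner (code o)).setVar .player I.n ∧
      IsArgmin (fun i => Wants I k i w ∧ h.arr .height i < I.n) (fun i => h.arr .height i) o := by
  refine run_argmin _ h (by decide) I.readInput_zero (fun o i => ?_) fun b i => by simp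
  have hsat := eval_satisfies_eq_zero (I := I)
    (h := (h.setVar .partner (code (n := I.n) o)).setVar .player i)
    (i := Var.player) (i' := i) (v := (Var.current : ForExpr Var Arr) - 1) (v' := w)
    (by simp) (by simp [hw])
  rw [ForExpr.eval_and_eq_zero, ForExpr.eval_and_eq_zero, hsat]
  simp only [Wants, not_and_or, not_not, ForExpr.eval_ne_eq_zero, ForExpr.eval_lt_eq_zero]
  simp [hk, Fin.val_inj]

end StarCFD

namespace StarCFD

open RAM ForProg ItemMatching

variable {I : CFDInstance} {k : Fin I.n} {S T : Finset (Fin I.m)} {v : Fin I.m}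
  {h : Store Var Arr}

/-- The entries of an array that belong to the players. -/
def ofPlayers (I : CFDInstance) (h : Store Var Arr) (a : Arr) : Fin I.n → ℕ := h.arr a ∘ Fin.val

/-- The array `holding` represents a matching of the items of `S` with the players other than the
owner `k` of the center. -/
def HoldsMatching (I : CFDInstance) (k : Fin I.n) (S : Finset (Fin I.m)) (h : Store Var Arr) :
    Prop :=
  ∃ holds, ofPlayers I h .holding = code ∘ holds ∧ IsMatching (Wants I k) holds S

/-- The situation after `t` pushes: unless nothing is floating or the floating item is stuck, the
sum of the heights is at least `t`. -/
structure Inserting (I : CFDInstance) (k : Fin I.n) (T : Finset (Fin I.m)) (t : ℕ)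
    (h : Store Var Arr) : Prop where
  owner : h.var .owner = k
  insertion : ∃ holds floating, ofPlayers I h .holding = code ∘ holds ∧
    h.var .current = code floating ∧
    Insertion (Wants I k) holds (ofPlayers I h .height) floating T ∧
    ∀ w ∈ floating, (∀ i, Wants I k i w → I.n ≤ ofPlayers I h .height i) ∨
      t ≤ ∑ i, ofPlayers I h .height i

theorem Inserting.setVar {t : ℕ} (hh : Inserting I k T t h) {x : Var}
    (hx : x ∉ [Var.owner, .current]) (j : ℕ) : Inserting I k T t (h.setVar x j) := by
  simp only [List.mem_cons, List.not_mem_nil, or_false, not_or, ← ne_eq] at hx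
  exact ⟨by simpa [hx.1.symm] using hh.owner,
    by simpa [hx.2.symm, ofPlayers] using hh.insertion⟩

theorem Inserting.handOver {t : ℕ} {b : Fin I.n} {w : Fin I.m} (hh : Inserting I k T t h)
    (hcurrent : h.var .current = code (some w)) (hpartner : h.var .partner = code (some b))
    (hb : IsArgmin (fun i => Wants I k i w ∧ h.arr .height i < I.n) (fun i => h.arr .height i)
      (some b)) : Inserting I k T (t + 1) (handOver.run I.encode h) := by
  obtain ⟨hk, holds, floating, hholding, hfloating, hins, ht⟩ := hh
  obtain ⟨⟨hwants, hlt⟩, hmin⟩ := hb.isLeast b rfl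
  obtain rfl : floating = some w := code_injective (hfloating.symm.trans hcurrent)
  have hmin' (j : Fin I.n) (hj : Wants I k j w) : h.arr .height b ≤ h.arr .height j := by
    rcases lt_or_ge (h.arr .height j) I.n with hjn | hjn
    exacts [hmin j ⟨hj, hjn⟩, hlt.le.trans hjn]
  have hholding' : ofPlayers I (StarCFD.handOver.run I.encode h) .holding =
      code ∘ Function.update holds b (some w) := by
    rw [Function.comp_update, ← hholding, ofPlayers, ofPlayers,
      ← Function.update_comp_eq_of_injective _ Fin.val_injective]
    simp [StarCFD.handOver, hcurrent, hpartner]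
  have hheight' : ofPlayers I (StarCFD.handOver.run I.encode h) .height =
      Function.update (ofPlayers I h .height) b (ofPlayers I h .height b + 1) := by
    rw [ofPlayers, ofPlayers, ← Function.update_comp_eq_of_injective _ Fin.val_injective]
    simp [StarCFD.handOver, hpartner]
  refine ⟨by simpa [StarCFD.handOver] using hk, _, holds b, hholding', ?_, ?_, fun _ _ => ?_⟩
  · simpa [StarCFD.handOver, hpartner, ofPlayers] using congrFun hholding b
  · rw [hheight']
    exact hins.update hwants (by simpa [ofPlayers] using hlt) hmin'
  · have hsum := (ht w rfl).resolve_left fun hstuck => (hstuck b hwants).not_gt hlt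
    rw [hheight', Finset.sum_update_of_mem (Finset.mem_univ b)]
    rw [Finset.sum_eq_add_sum_sdiff_singleton_of_mem (Finset.mem_univ b)] at hsum
    exact Or.inr (by omega)

theorem Inserting.push {t : ℕ} (hh : Inserting I k T t h) :
    Inserting I k T (t + 1) (push.run I.encode h) := by
  obtain ⟨hk, holds, floating, hholding, hcurrent, hins, ht⟩ := id hh
  rw [StarCFD.push, run_ite, ForExpr.eval_var, hcurrent]
  rcases floating with _ | w
  · rw [code_none, if_pos rfl, run_skip]
    exact ⟨hk, holds, none, hholding, hcurrent, hins, by simp⟩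
  obtain ⟨o, hrun, ho⟩ := run_findPartner hk hcurrent
  have hh' := (hh.setVar (x := .partner) (by decide) (code o)).setVar (x := .player) (by decide) I.n
  rw [← hrun] at hh'
  have hpartner : (findPartner.run I.encode h).var .partner = code o := by simp [hrun]
  have hcurrent' : (findPartner.run I.encode h).var .current = code (some w) := by
    simp [hrun, hcurrent]
  rw [if_neg (by simp), run_seq, run_ite, ForExpr.eval_var, hpartner]
  rcases o with _ | b
  · have hstuck (i : Fin I.n) (hi : Wants I k i w) : I.n ≤ h.arr .height i :=
      not_lt.1 fun hlt => ho.eq_none rfl i ⟨hi, hlt⟩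
    have hnext : Inserting I k T (t + 1) h :=
      ⟨hk, holds, some w, hholding, hcurrent, hins, by simpa [ofPlayers] using Or.inl hstuck⟩
    rw [code_none, if_pos rfl, run_skip, hrun]
    exact (hnext.setVar (by decide) _).setVar (by decide) _
  · rw [if_neg (by simp)]
    exact hh'.handOver hcurrent' hpartner (by simpa [hrun] using ho)

theorem Inserting.pushAll (hh : Inserting I k T 0 h) :
    Inserting I k T (I.n * I.n) (pushAll.run I.encode h) := by
  rw [← I.readInput_zero]
  refine run_upTo_induction I.encode h (by decide)
    (fun j h' => Inserting I k T (j * readInput I.encode 0) h')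
    (by simpa using hh.setVar (x := .outer) (by decide) 0) fun j h' _ _ _ _ hj => ?_
  rw [Nat.add_mul, one_mul]
  refine Inserting.setVar ?_ (by decide) _
  exact run_upTo_induction I.encode h' (by decide)
    (fun i h'' => Inserting I k T (j * readInput I.encode 0 + i) h'')
    (hj.setVar (by decide) 0) fun i h'' _ _ _ _ hi => hi.push.setVar (by decide) _

theorem forall_le_of_card_mul_le_sum {ι : Type*} [Fintype ι] {f : ι → ℕ} {n : ℕ}
    (hf : ∀ i, f i ≤ n) (hsum : Fintype.card ι * n ≤ ∑ i, f i) (i : ι) : n ≤ f i := by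
  have heq := (Finset.sum_eq_sum_iff_of_le fun i _ => hf i).1
    (le_antisymm (Finset.sum_le_sum fun i _ => hf i) (by rwa [Finset.sum_const, smul_eq_mul]))
  exact (heq i (Finset.mem_univ i)).ge

theorem Inserting.holdsMatching_or_exists_card_lt (hh : Inserting I k T (I.n * I.n) h) :
    h.var .current = 0 ∧ HoldsMatching I k T h ∨
      h.var .current ≠ 0 ∧ ∃ D, D.card < (captured (Wants I k) D T).card := by
  obtain ⟨-, holds, floating | w, hholding, hcurrent, hins, ht⟩ := hh
  · exact Or.inl ⟨hcurrent, holds, hholding, hins.isMatching⟩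
  · refine Or.inr ⟨by simp [hcurrent], hins.exists_card_lt_of_stuck ?_⟩
    rw [Fintype.card_fin]
    rcases ht w rfl with hstuck | hsum
    · exact hstuck
    · exact fun j _ => forall_le_of_card_mul_le_sum
        (fun i => (hins.height_le i).trans_eq (Fintype.card_fin _)) (by simpa using hsum) j

theorem run_tryInsert (hk : h.var .owner = k) (hmatching : HoldsMatching I k S h)
    (hbest : h.var .best = code (some v)) (hv : v ∉ S) :
    Inserting I k (insert v S) (I.n * I.n) (tryInsert.run I.encode h) ∧
      ofPlayers I (tryInsert.run I.encode h) .backup = ofPlayers I h .holding := by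
  obtain ⟨holds, hholding, hmatching⟩ := hmatching
  rw [tryInsert, run_seq, run_seq]
  set h₁ := (fill .player 0 .backup (.arr .holding Var.player)).run I.encode h with h₁_def
  set h₂ := (fill .player 0 .height 0).run I.encode h₁ with h₂_def
  have hbackup : ofPlayers I h₁ .backup = ofPlayers I h .holding := by
    funext i
    refine run_fill I.encode h (fun j h' hj hframe => ?_) i (by simp)
    rw [ForExpr.eval_arr, ForExpr.eval_var, hj, hframe _ (by decide)]
  have hheight : ofPlayers I h₂ .height = fun _ => 0 := by
    funext i
    exact run_fill (f := fun _ => 0) I.encode h₁ (fun _ _ _ _ => rfl) i (by simp)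
  have hholding₂ : h₂.arr .holding = h.arr .holding := by
    rw [h₂_def, run_arr_of_notMem _ _ (by decide), h₁_def, run_arr_of_notMem _ _ (by decide)]
  have hvar (x : Var) (hx : x ≠ .player) : h₂.var x = h.var x := by
    rw [h₂_def, run_var_of_notMem _ _ (by simpa [fill, vars] using hx), h₁_def,
      run_var_of_notMem _ _ (by simpa [fill, vars] using hx)]
  refine ⟨Inserting.pushAll ⟨?_, holds, some v, ?_, ?_, ?_, by simp⟩, ?_⟩
  · simpa [hvar] using hk
  · simpa [ofPlayers, hholding₂] using hholding
  · simpa [hvar] using hbest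
  · have hstart := Insertion.start hmatching hv
    rwa [← hheight] at hstart
  · rw [← hbackup]
    simp only [ofPlayers, run_seq]
    rw [run_arr_of_notMem _ _ (by decide), run_set, Store.setVar_arr, h₂_def,
      run_arr_of_notMem _ _ (by decide)]

end StarCFD

namespace StarCFD

open RAM ForProg ItemMatching

variable {I : CFDInstance} {k : Fin I.n} {S : Finset (Fin I.m)} {v c : Fin I.m}
  {h h' : Store Var Arr}

/-- The variables of the algorithm record the size of `S`, and the cost of its items for the owner
`k` of the center as a fraction. -/
structure Tally (I : CFDInstance) (k : Fin I.n) (S : Finset (Fin I.m)) (h : Store Var Arr) :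
    Prop where
  owner : h.var .owner = k
  count : h.var .count = S.card
  denom_pos : 0 < h.var .denom
  cost : (h.var .numer / h.var .denom : ℚ) = ∑ w ∈ S, I.u k w

theorem Tally.congr (hh : Tally I k S h)
    (hvar : ∀ x ∈ [Var.owner, .count, .numer, .denom], h'.var x = h.var x) : Tally I k S h' := by
  simp only [List.forall_mem_cons] at hvar
  obtain ⟨howner, hcount, hnumer, hdenom, -⟩ := hvar
  exact ⟨howner ▸ hh.owner, hcount ▸ hh.count, hdenom ▸ hh.denom_pos, hnumer ▸ hdenom ▸ hh.cost⟩

theorem Tally.record (hh : Tally I k S h) (hbest : h.var .best = code (some v)) (hv : v ∉ S) :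
    Tally I k (insert v S) (record.run I.encode h) := by
  have hnum : (num Var.owner (Var.best - 1)).eval I.encode h = (I.u k v).num.toNat :=
    eval_num (by simp [hh.owner]) (by simp [hbest])
  have hden {h' : Store Var Arr} (howner : h'.var .owner = h.var .owner)
      (hbest' : h'.var .best = h.var .best) :
      (den Var.owner (Var.best - 1)).eval I.encode h' = (I.u k v).den :=
    eval_den (by simp [howner, hh.owner]) (by simp [hbest', hbest])
  have hnumer : (StarCFD.record.run I.encode h).var .numer =
      h.var .numer * (I.u k v).den + h.var .denom * (I.u k v).num.toNat := by
    simp [StarCFD.record, hnum, hden rfl rfl]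
  have hdenom : (StarCFD.record.run I.encode h).var .denom = h.var .denom * (I.u k v).den := by
    simp [StarCFD.record, hden]
  have hpos := hh.denom_pos
  refine ⟨by simp [StarCFD.record, hh.owner], ?_, ?_, ?_⟩
  · simp [StarCFD.record, hh.count, Finset.card_insert_of_notMem hv]
  · exact hdenom ▸ Nat.mul_pos hpos (I.u k v).den_pos
  · rw [hnumer, hdenom, Finset.sum_insert hv, ← hh.cost, add_comm (I.u k v)]
    conv_rhs => rw [I.utility_eq_div k v]
    rw [div_add_div _ _ (mod_cast hpos.ne') (mod_cast (I.u k v).den_ne_zero)]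
    simp only [Nat.cast_add, Nat.cast_mul]

theorem HoldsMatching.congr (hh : HoldsMatching I k S h)
    (hholding : ofPlayers I h' .holding = ofPlayers I h .holding) : HoldsMatching I k S h' := by
  simpa only [HoldsMatching, hholding] using hh

theorem ofPlayers_restore :
    ofPlayers I (restore.run I.encode h) .holding = ofPlayers I h .backup := by
  funext i
  refine run_fill I.encode h (fun j h' hj hframe => ?_) i (by simp)
  rw [ForExpr.eval_arr, ForExpr.eval_var, hj, hframe _ (by decide)]

theorem run_process (hT : Tally I k S h) (hS : HoldsMatching I k S h)
    (hbest : h.var .best = code (some v)) (hv : v ∉ S) :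
    ∃ S', Tally I k S' (process.run I.encode h) ∧ HoldsMatching I k S' (process.run I.encode h) ∧
      (S' = insert v S ∨
        S' = S ∧ ∃ D, D.card < (captured (Wants I k) D (insert v S)).card) := by
  rw [process, run_seq, run_seq, run_ite, ForExpr.eval_var]
  set h₁ := (store .done ((Var.best : ForExpr Var Arr) - 1) 1).run I.encode h
  set h₂ := tryInsert.run I.encode h₁ with h₂_def
  have hvar (x : Var) (hx : x ∈ [Var.owner, .count, .numer, .denom, .best]) :
      h₂.var x = h.var x := by
    have : x ∉ tryInsert.vars := by revert hx; cases x <;> decide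
    rw [h₂_def, run_var_of_notMem _ _ this]
    rfl
  have hT₂ := hT.congr fun x hx => hvar x (by revert hx; cases x <;> decide)
  have hbest₂ := (hvar .best (by decide)).trans hbest
  obtain ⟨hins, hbackup⟩ := run_tryInsert (h := h₁) hT.owner hS hbest hv
  rcases hins.holdsMatching_or_exists_card_lt with ⟨hcurrent, hmatching⟩ | ⟨hcurrent, hD⟩
  · rw [if_pos hcurrent]
    refine ⟨insert v S, hT₂.record hbest₂ hv, hmatching.congr ?_, Or.inl rfl⟩
    rw [ofPlayers, run_arr_of_notMem _ _ (by decide), ofPlayers]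
  · rw [if_neg hcurrent]
    refine ⟨S, hT₂.congr fun x hx => run_var_of_notMem _ _ ?_,
      hS.congr (ofPlayers_restore.trans hbackup), Or.inr ⟨rfl, hD⟩⟩
    revert hx
    cases x <;> decide

/-- The items of `X` have been offered to the matching in order of increasing utility for the owner
`k` of the center `c`, and those of `S` have been chosen. -/
structure Offered (I : CFDInstance) (k : Fin I.n) (c : Fin I.m) (X S : Finset (Fin I.m))
    (h : Store Var Arr) : Prop where
  tally : Tally I k S h
  matching : HoldsMatching I k S h
  greedy : IsGreedy (Wants I k) (I.u k) X S
  notMem : c ∉ X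
  done_eq_zero : ∀ w : Fin I.m, h.arr .done w = 0 ↔ w ≠ c ∧ w ∉ X
  sorted : ∀ w ∈ X, ∀ w' ∉ X, w' ≠ c → I.u k w ≤ I.u k w'

theorem Offered.setVar {X : Finset (Fin I.m)} (hh : Offered I k c X S h) {x : Var}
    (hx : x ∉ [Var.owner, .count, .numer, .denom]) (j : ℕ) :
    Offered I k c X S (h.setVar x j) where
  tally := hh.tally.congr fun y hy => by simp [ne_of_mem_of_not_mem hy hx]
  matching := hh.matching
  greedy := hh.greedy
  notMem := hh.notMem
  done_eq_zero := hh.done_eq_zero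
  sorted := hh.sorted

theorem Offered.process {X : Finset (Fin I.m)} (hh : Offered I k c X S h)
    (hbest : h.var .best = code (some v))
    (hv : h.arr .done v = 0 ∧ ∀ w : Fin I.m, h.arr .done w = 0 → I.u k v ≤ I.u k w) :
    ∃ S', Offered I k c (insert v X) S' (process.run I.encode h) := by
  obtain ⟨⟨hvc, hvX⟩, hmin⟩ := hv.imp_left (hh.done_eq_zero v).1
  have hvS : v ∉ S := fun hvS => hvX (hh.greedy.subset hvS)
  obtain ⟨S', htally, hmatching, hS'⟩ := run_process hh.tally hh.matching hbest hvS
  have hdone (w : Fin I.m) : (StarCFD.process.run I.encode h).arr .done w =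
      if w = v then 1 else h.arr .done w := by
    rw [StarCFD.process, run_seq, run_seq, run_arr_of_notMem _ _ (by decide),
      run_arr_of_notMem _ _ (by decide)]
    simp [hbest, Function.update_apply, Fin.ext_iff]
  refine ⟨S', htally, hmatching, ?_, ?_, fun w => ?_, fun w hw w' hw' hw'c => ?_⟩
  · rcases hS' with rfl | ⟨rfl, hD⟩
    · exact hh.greedy.accept v
    · obtain ⟨holds, -, hS⟩ := hh.matching
      exact hh.greedy.reject hS.hallCondition (fun w hw => hh.sorted w hw v hvX hvc) hD
  · rw [Finset.mem_insert, not_or]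
    exact ⟨hvc.symm, hh.notMem⟩
  · rw [hdone, Finset.mem_insert]
    split_ifs with hwv
    · simp [hwv]
    · simp [hwv, hh.done_eq_zero]
  · rw [Finset.mem_insert, not_or] at hw'
    rcases Finset.mem_insert.1 hw with rfl | hw
    · exact hmin w' ((hh.done_eq_zero w').2 ⟨hw'c, hw'.2⟩)
    · exact hh.sorted w hw w' hw'.2 hw'c

theorem run_greedy (hh : ∃ S, Offered I k c ∅ S h) :
    ∃ S, Offered I k c (Finset.univ.erase c) S (greedy.run I.encode h) := by
  have hfinal : ∃ X S, Offered I k c X S (greedy.run I.encode h) ∧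
      (X = Finset.univ.erase c ∨ readInput I.encode 1 ≤ X.card) := by
    obtain ⟨S, hh⟩ := hh
    refine run_upTo_induction I.encode h (by decide) (fun j h' => ∃ X S, Offered I k c X S h' ∧
      (X = Finset.univ.erase c ∨ j ≤ X.card)) ⟨∅, S, hh.setVar (by decide) _, by simp⟩ ?_
    rintro j h' - - - - ⟨X, S, hh', hX⟩
    obtain ⟨o, hrun, ho⟩ := run_select hh'.tally.owner
    have hselect : Offered I k c X S (select.run I.encode h') :=
      hrun ▸ (hh'.setVar (by decide) _).setVar (by decide) _
    have hbest : (select.run I.encode h').var .best = code o := by simp [hrun]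
    rw [run_seq, run_ite, ForExpr.eval_var, hbest]
    rcases o with _ | v
    · rw [code_none, if_pos rfl, run_skip]
      refine ⟨X, S, hselect.setVar (by decide) _, Or.inl ?_⟩
      ext w
      have hw := mt (hh'.done_eq_zero w).2 (ho.eq_none rfl w)
      rw [Finset.mem_erase, and_iff_left (Finset.mem_univ w)]
      exact ⟨fun hwX hwc => hh'.notMem (hwc ▸ hwX), fun hwc => by tauto⟩
    · rw [if_neg (by simp)]
      obtain ⟨S', hprocess⟩ := hselect.process hbest (by simpa [hrun] using ho.isLeast v rfl)
      refine ⟨insert v X, S', hprocess.setVar (by decide) _, Or.inr ?_⟩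
      obtain ⟨hvc, hvX⟩ := (hh'.done_eq_zero v).1 (ho.isLeast v rfl).1
      rw [Finset.card_insert_of_notMem hvX]
      refine Nat.succ_le_succ (hX.resolve_left ?_)
      rintro rfl
      exact hvX (Finset.mem_erase.2 ⟨hvc, Finset.mem_univ v⟩)
  obtain ⟨X, S, hX, rfl | hcard⟩ := hfinal
  · exact ⟨S, hX⟩
  · have hlt : X.card < I.m := by
      simpa using Finset.card_lt_univ_of_notMem hX.notMem
    rw [I.readInput_one] at hcard
    omega

end StarCFD

namespace StarCFD

open RAM ForProg ItemMatching

variable {I : CFDInstance} {k : Fin I.n} {S : Finset (Fin I.m)} {c : Fin I.m}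
  {h : Store Var Arr}

/-- The players other than `k` can be satisfied with single items other than the center `c` whose
total utility for `k` is at most `1 - 1 / n`; the rest of the star then satisfies `k`. -/
def CanOwnCenter (I : CFDInstance) (k : Fin I.n) (c : Fin I.m) : Prop :=
  ∃ holds S, IsMatching (Wants I k) holds S ∧ c ∉ S ∧ S.card + 1 = I.n ∧
    ∑ w ∈ S, I.u k w ≤ 1 - 1 / (I.n : ℚ)

theorem card_lt_of_hallCondition (hS : HallCondition (Wants I k) S) : S.card < I.n := by
  have hcaptured : captured (Wants I k) (Finset.univ.erase k) S = S := by
    ext w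
    simp +contextual [mem_captured, Wants]
  have hle := hS (Finset.univ.erase k)
  rw [hcaptured] at hle
  simpa using hle.trans_lt (Finset.card_erase_lt_of_mem (Finset.mem_univ k))

theorem Offered.canOwnCenter_iff (hh : Offered I k c (Finset.univ.erase c) S h) :
    CanOwnCenter I k c ↔ S.card + 1 = I.n ∧ ∑ w ∈ S, I.u k w ≤ 1 - 1 / (I.n : ℚ) := by
  obtain ⟨holds, -, hS⟩ := hh.matching
  constructor
  · rintro ⟨holds', T, hT, hcT, hcard, hcost⟩
    have hTX : T ⊆ Finset.univ.erase c := fun w hw =>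
      Finset.mem_erase.2 ⟨ne_of_mem_of_not_mem hw hcT, Finset.mem_univ w⟩
    have hle := hh.greedy.card_le hT.hallCondition hTX
    have hlt := card_lt_of_hallCondition hS.hallCondition
    refine ⟨by omega, le_trans ?_ hcost⟩
    exact sum_le_sum_of_card_filter_le (by omega) (hh.greedy.card_filter_le hT.hallCondition hTX)
  · exact fun ⟨hcard, hcost⟩ =>
      ⟨holds, S, hS, fun hc => hh.notMem (hh.greedy.subset hc), hcard, hcost⟩

theorem run_reset (hk : h.var .owner = k) (hc : h.var .center = c) :
    Offered I k c ∅ ∅ (reset.run I.encode h) := by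
  set h₁ := (fill .player 0 .holding 0).run I.encode h with h₁_def
  set h₂ := (fill .item 1 .done 0).run I.encode h₁ with h₂_def
  have hholding : ofPlayers I h₂ .holding = code ∘ fun _ => (none : Option (Fin I.m)) := by
    funext i
    rw [ofPlayers, h₂_def, run_arr_of_notMem _ _ (by decide), h₁_def]
    exact run_fill (f := fun _ => 0) I.encode h (fun _ _ _ _ => rfl) i (by simp)
  have hdone (w : Fin I.m) : h₂.arr .done w = 0 :=
    run_fill (f := fun _ => 0) I.encode h₁ (fun _ _ _ _ => rfl) w (by simp)
  have hframe {x : Var} (hx : x ∉ [Var.player, .item]) : h₂.var x = h.var x := by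
    simp only [List.mem_cons, List.not_mem_nil, or_false, not_or] at hx
    rw [h₂_def, run_var_of_notMem _ _ (by simpa [fill, vars] using hx.2), h₁_def,
      run_var_of_notMem _ _ (by simpa [fill, vars] using hx.1)]
  have hdone' (w : Fin I.m) : (reset.run I.encode h).arr .done w = if w = c then 1 else 0 := by
    simp [reset, ← h₁_def, ← h₂_def, hframe, hc, Function.update_apply, Fin.val_inj, hdone]
  refine ⟨⟨?_, ?_, ?_, ?_⟩, ⟨_, hholding, .empty⟩, .empty, by simp,
    by simp [hdone'], by simp⟩
  · exact (run_var_of_notMem _ _ (by decide)).trans hk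
  · simp [reset]
  · simp [reset]
  · simp [reset]

theorem Tally.verdict (hh : Tally I k S h) :
    (verdict.run I.encode h).var .answer =
      if S.card + 1 = I.n ∧ ∑ w ∈ S, I.u k w ≤ 1 - 1 / (I.n : ℚ) then 1 else h.var .answer := by
  have hcost : ∑ w ∈ S, I.u k w ≤ 1 - 1 / (I.n : ℚ) ↔
      I.n * h.var .numer + h.var .denom ≤ I.n * h.var .denom := by
    have hn : (0 : ℚ) < I.n := mod_cast k.pos
    have hd : (0 : ℚ) < h.var .denom := mod_cast hh.denom_pos
    rw [← hh.cost, le_sub_iff_add_le, div_add_div _ _ hd.ne' hn.ne', div_le_one (mul_pos hd hn),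
      mul_comm (h.var .numer : ℚ), mul_one, mul_comm (h.var .denom : ℚ)]
    norm_cast
  simp only [hcost, StarCFD.verdict, run_ite, run_skip, run_set, ForExpr.eval_ne_eq_zero,
    ForExpr.eval_le_eq_zero, ForExpr.eval_add, ForExpr.eval_mul, ForExpr.eval_var,
    ForExpr.eval_ofNat, eval_players, hh.count]
  split_ifs <;> simp_all

open Classical in
theorem run_owner (hk : h.var .owner = k) (hc : h.var .center = c) :
    ((reset ;; greedy ;; verdict).run I.encode h).var .answer =
      if CanOwnCenter I k c then 1 else h.var .answer := by
  obtain ⟨S, hS⟩ := run_greedy ⟨∅, run_reset hk hc⟩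
  simp only [hS.canOwnCenter_iff]
  rw [run_seq, run_seq, hS.tally.verdict, run_var_of_notMem _ _ (by decide),
    run_var_of_notMem _ _ (by decide)]

open Classical in
theorem run_decideProp (hI : ∃ c, I.G.IsUniversal c) :
    ∃ c, I.G.IsUniversal c ∧ (decideProp.run I.encode .zero).var .answer =
      if I.n = 0 ∨ ∃ k, CanOwnCenter I k c then 1 else 0 := by
  obtain ⟨c, hc, hcenter⟩ := run_findCenter .zero hI
  refine ⟨c, hc, ?_⟩
  rw [decideProp, run_seq, run_seq]
  set h₀ := (ite players skip (.answer ::= 1)).run I.encode (findCenter.run I.encode .zero)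
    with h₀_def
  have hcenter₀ : h₀.var .center = c := by rw [h₀_def, run_var_of_notMem _ _ (by decide), hcenter]
  have hanswer₀ : h₀.var .answer = if I.n = 0 then 1 else 0 := by
    have hzero : (findCenter.run I.encode .zero).var .answer = 0 :=
      run_var_of_notMem _ _ (by decide)
    rw [h₀_def, run_ite, eval_players]
    split_ifs <;> simp [hzero]
  have hfinal := run_upTo_induction (p := reset ;; greedy ;; verdict) (x := .owner) (k := 0)
    I.encode h₀ (by decide)
    (fun j h => h.var .answer =
      if I.n = 0 ∨ ∃ k : Fin I.n, (k : ℕ) < j ∧ CanOwnCenter I k c then 1 else 0)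
    (by simpa using hanswer₀) ?_
  · simpa using hfinal
  intro j h hj howner hframe _ hanswer
  obtain ⟨k, rfl⟩ : ∃ k : Fin I.n, (k : ℕ) = j := ⟨⟨j, by simpa using hj⟩, rfl⟩
  rw [Store.setVar_var, if_neg (by decide),
    run_owner howner ((hframe _ (by decide)).trans hcenter₀), hanswer]
  simp only [Nat.lt_succ_iff_lt_or_eq, Fin.val_inj, or_and_right, exists_or, exists_eq_left]
  by_cases hk : CanOwnCenter I k c <;> simp [hk]

end StarCFD

/-! ### Proportional allocations on stars -/

namespace StarCFD

open SimpleGraph ItemMatching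

section Star

variable {V : Type*} {G : SimpleGraph V} {c d : V} {X : Set V}

theorem starGraph_eq_of_isUniversal (hd : (starGraph c).IsUniversal d) :
    starGraph c = starGraph d := by
  ext x y
  have hx := @hd x
  have hy := @hd y
  simp only [starGraph_adj] at hx hy ⊢
  grind

theorem preconnected_induce_of_isUniversal (hG : G.IsUniversal c) (hc : c ∈ X) :
    (G.induce X).Preconnected :=
  (Connected.of_isUniversal (v := ⟨c, hc⟩) fun _ hw => hG (Subtype.coe_ne_coe.2 hw)).preconnected

theorem subsingleton_of_preconnected_induce_starGraph
    (hX : ((starGraph c).induce X).Preconnected) (hc : c ∉ X) : X.Subsingleton := by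
  have hbot : (starGraph c).induce X = ⊥ := by
    ext x y
    have hx := ne_of_mem_of_not_mem x.2 hc
    have hy := ne_of_mem_of_not_mem y.2 hc
    simp [hx, hy]
  rw [hbot, preconnected_bot_iff_subsingleton] at hX
  exact Set.subsingleton_coe X |>.1 hX

end Star

section Allocation

variable {I : CFDInstance} {π : I.Allocation} {k i : Fin I.n} {c : Fin I.m}
  {holds : Fin I.n → Option (Fin I.m)} {S : Finset (Fin I.m)}

theorem nonempty_of_isProportional (hπ : I.IsProportional π) (i : Fin I.n) : (π i).Nonempty := by
  have hn : (0 : ℚ) < I.n := mod_cast i.pos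
  refine Finset.nonempty_of_sum_ne_zero (f := I.u i) (ne_of_gt ?_)
  exact (one_div_pos.2 hn).trans_le (hπ i)

theorem exists_eq_singleton (hG : I.G = starGraph c) (hvalid : I.IsValid π)
    (hprop : I.IsProportional π) (hi : c ∉ π i) : ∃ w, π i = {w} := by
  have hsub := subsingleton_of_preconnected_induce_starGraph (hG ▸ hvalid.1 i) hi
  exact Finset.card_eq_one.1 (le_antisymm (Finset.card_le_one_iff_subsingleton.2 hsub)
    (nonempty_of_isProportional hprop i).card_pos)

theorem canOwnCenter_of_isValid (hG : I.G = starGraph c) (hvalid : I.IsValid π)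
    (hprop : I.IsProportional π) (hk : ∀ i, i ≠ k → c ∉ π i) : CanOwnCenter I k c := by
  have hsingleton : ∀ i, i ≠ k → ∃ w, π i = {w} := fun i hi =>
    exists_eq_singleton hG hvalid hprop (hk i hi)
  have : Nonempty (Fin I.m) := ⟨c⟩
  choose! w hw using hsingleton
  have hne : ∀ i ∈ Finset.univ.erase k, i ≠ k := fun i => Finset.ne_of_mem_erase
  have hinj : Set.InjOn w (Finset.univ.erase k : Finset (Fin I.n)) := by
    intro i hi j hj hij
    by_contra hne'
    have hdisj := hvalid.2 i j hne'
    rw [hw i (hne i hi), hw j (hne j hj), hij] at hdisj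
    simp at hdisj
  refine ⟨_, _, .of_injOn (fun i hi => ⟨hne i hi, ?_⟩) hinj, ?_, ?_, ?_⟩
  · simpa [CFDInstance.value, hw i (hne i hi)] using hprop i
  · rw [Finset.mem_image]
    rintro ⟨i, hi, rfl⟩
    exact hk i (hne i hi) (by simp [hw i (hne i hi)])
  · rw [Finset.card_image_of_injOn hinj, Finset.card_erase_add_one (Finset.mem_univ k),
      Finset.card_fin]
  · have hdisj : Disjoint ((Finset.univ.erase k).image w) (π k) := by
      rw [Finset.disjoint_left, Finset.forall_mem_image]
      intro i hi
      rw [← Finset.disjoint_singleton_left, ← hw i (hne i hi)]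
      exact hvalid.2 i k (hne i hi)
    rw [le_sub_iff_add_le]
    calc _ ≤ _ + I.value k (π k) := by gcongr; exact hprop k
      _ = ∑ v ∈ (Finset.univ.erase k).image w ∪ π k, I.u k v := (Finset.sum_union hdisj).symm
      _ ≤ ∑ v, I.u k v := Finset.sum_le_univ_sum_of_nonneg (I.u_nonneg k)
      _ = 1 := I.u_sum k

theorem canOwnCenter_of_propCFD (hG : I.G = starGraph c) (hn : I.n ≠ 0) (hI : I.PropCFD) :
    ∃ k, CanOwnCenter I k c := by
  obtain ⟨π, hvalid, hprop⟩ := hI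
  obtain ⟨k, hk⟩ : ∃ k, ∀ i, i ≠ k → c ∉ π i := by
    by_cases hown : ∃ k, c ∈ π k
    · obtain ⟨k, hk⟩ := hown
      exact ⟨k, fun i hi hci => Finset.disjoint_left.1 (hvalid.2 i k hi) hci hk⟩
    · exact ⟨⟨0, Nat.pos_of_ne_zero hn⟩, fun i _ hci => hown ⟨i, hci⟩⟩
  exact ⟨k, canOwnCenter_of_isValid hG hvalid hprop hk⟩

theorem exists_holds_of_card_add_one_eq (hS : IsMatching (Wants I k) holds S)
    (hcard : S.card + 1 = I.n) (hi : i ≠ k) : ∃ w, holds i = some w := by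
  have hsub : ({i | (holds i).isSome} : Finset (Fin I.n)) ⊆ Finset.univ.erase k := by
    intro j hj
    obtain ⟨w, hw⟩ := Option.isSome_iff_exists.1 (Finset.mem_filter_univ j |>.1 hj)
    exact Finset.mem_erase.2 ⟨(hS.wants j w hw).1, Finset.mem_univ j⟩
  have hall := Finset.eq_of_subset_of_card_le hsub <| by
    rw [← hS.card_eq, Finset.card_erase_of_mem (Finset.mem_univ k), Finset.card_fin]
    omega
  rw [← Option.isSome_iff_exists, ← Finset.mem_filter_univ (p := fun i => (holds i).isSome), hall]
  exact Finset.mem_erase.2 ⟨hi, Finset.mem_univ i⟩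

/-- The allocation in which player `k` takes everything that the others do not hold. -/
def leaveRest (I : CFDInstance) (k : Fin I.n) (holds : Fin I.n → Option (Fin I.m))
    (S : Finset (Fin I.m)) : I.Allocation :=
  fun i => if i = k then Sᶜ else (holds i).toFinset

theorem isValid_leaveRest (hG : I.G.IsUniversal c) (hS : IsMatching (Wants I k) holds S)
    (hc : c ∉ S) : I.IsValid (leaveRest I k holds S) := by
  have hsub (i : Fin I.n) : (holds i).toFinset ⊆ S := fun w hw =>
    (hS.mem_iff w).2 ⟨i, by simpa using hw⟩
  refine ⟨fun i => ?_, fun i j hij => ?_⟩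
  · by_cases hi : i = k
    · exact preconnected_induce_of_isUniversal hG (by simpa [leaveRest, hi] using hc)
    · have : Subsingleton ((leaveRest I k holds S i : Finset (Fin I.m)) : Set (Fin I.m)) := by
        rw [Set.subsingleton_coe, leaveRest, if_neg hi]
        cases holds i <;> simp
      exact Preconnected.of_subsingleton
  · simp only [leaveRest]
    split_ifs with hi hj hj
    · exact absurd (hi.trans hj.symm) hij
    · exact disjoint_compl_left.mono_right (hsub j)
    · exact disjoint_compl_right.mono_left (hsub i)
    · rw [Finset.disjoint_left]
      intro w hwi hwj
      exact hij (hS.inj i j w (by simpa using hwi) (by simpa using hwj))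

theorem isProportional_leaveRest (hS : IsMatching (Wants I k) holds S)
    (hcard : S.card + 1 = I.n) (hcost : ∑ w ∈ S, I.u k w ≤ 1 - 1 / (I.n : ℚ)) :
    I.IsProportional (leaveRest I k holds S) := by
  intro i
  by_cases hi : i = k
  · subst hi
    have hsum := Finset.sum_add_sum_compl S (I.u i)
    rw [I.u_sum] at hsum
    simp only [CFDInstance.value, leaveRest, if_true]
    linarith
  · obtain ⟨w, hw⟩ := exists_holds_of_card_add_one_eq hS hcard hi
    simpa [CFDInstance.value, leaveRest, hi, hw] using (hS.wants i w hw).2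

theorem propCFD_iff (hG : I.G = starGraph c) :
    I.PropCFD ↔ I.n = 0 ∨ ∃ k, CanOwnCenter I k c := by
  refine ⟨fun hI => or_iff_not_imp_left.2 fun hn => canOwnCenter_of_propCFD hG hn hI, ?_⟩
  rintro (hn | ⟨k, holds, S, hS, hc, hcard, hcost⟩)
  · have : IsEmpty (Fin I.n) := by rw [hn]; infer_instance
    exact ⟨isEmptyElim, ⟨isEmptyElim, isEmptyElim⟩, isEmptyElim⟩
  · exact ⟨_, isValid_leaveRest (hG ▸ isUniversal_starGraph_self) hS hc,
      isProportional_leaveRest hS hcard hcost⟩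

end Allocation

section InputLength

variable {I : CFDInstance}

/-- The length of the encoding of an instance as an expression in the numbers of players and items,
which are found in the first two memory cells. -/
def inputLength : RAM.Expr :=
  .bin .add (.bin .add (.lit 2) (.bin .mul (.load (.lit 1)) (.load (.lit 1))))
    (.bin .mul (.lit 2) (.bin .mul (.load (.lit 0)) (.load (.lit 1))))

theorem eval_inputLength : inputLength.eval (RAM.init I.encode) = I.encode.length := by
  have h₀ : I.encode.getD 0 0 = I.n := I.readInput_zero
  have h₁ : I.encode.getD 1 0 = I.m := I.readInput_one
  simp only [inputLength, RAM.Expr.eval, RAM.Op.eval, RAM.init, h₀, h₁, I.length_encode]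

theorem readInput_le_length (hm : 0 < I.m) {b : ℕ} (hb : b ∈ decideProp.bounds) :
    RAM.readInput I.encode b ≤ I.encode.length := by
  have hb' : b = 0 ∨ b = 1 :=
    (by decide : ∀ b ∈ decideProp.bounds, b = 0 ∨ b = 1) b hb
  rw [I.length_encode]
  rcases hb' with rfl | rfl
  · rw [I.readInput_zero]
    nlinarith
  · rw [I.readInput_one]
    nlinarith

end InputLength

end StarCFD

theorem mainTheorem11 :
    RAM.SolvableInPolyTime CFDInstance.encode CFDInstance.IsStar CFDInstance.PropCFD := by
  classical
  have hanswer (I : CFDInstance) (hI : I.IsStar) :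
      (StarCFD.decideProp.run I.encode .zero).var .answer = if I.PropCFD then 1 else 0 := by
    obtain ⟨c₀, hG⟩ := hI
    obtain ⟨c, hc, hrun⟩ :=
      StarCFD.run_decideProp ⟨c₀, hG ▸ SimpleGraph.isUniversal_starGraph_self⟩
    have hGc := hG.trans (StarCFD.starGraph_eq_of_isUniversal (hG ▸ hc))
    simp only [hrun, StarCFD.propCFD_iff hGc]
  refine RAM.solvableInPolyTime_of_wellFormed StarCFD.wellFormed_decideProp .answer
    StarCFD.inputLength (fun I _ => ?_) (fun I _ => StarCFD.eval_inputLength) (fun I hI k hk => ?_)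
    (fun I hI hyes => by rw [hanswer I hI, if_pos hyes])
    fun I hI hno => by rw [hanswer I hI, if_neg hno]
  · rw [CFDInstance.length_encode]
    omega
  · exact StarCFD.readInput_le_length hI.choose.pos hk
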